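/- Let $a\neq 0$ be real, let $I\subseteq\mathbb R$ be open and let $\mathcal M:I\to\mathbb R$ be of class $C^3$. Put $\Sigma=r^2+a^2\cos^2\theta$, $\Delta_r=r^2-2\mathcal M(r)r+a^2$, $\varrho=r+ia\cos\theta$, $\bar\varrho=r-ia\cos\theta$, and consider the Kerr-like metric $$ds^2=-\frac{\Delta_r}{\Sigma}(dt-a\sin^2\theta\,d\phi)^2+\frac{\Sigma}{\Delta_r}dr^2+\Sigma\,d\theta^2+\frac{\sin^2\theta}{\Sigma}\bigl(a\,dt-(r^2+a^2)\,d\phi\bigr)^2$$ on the chart domain $U=\{(t,r,\theta,\phi): r\in I,\ 0<\theta<\pi,\ \Sigma\neq0,\ \Delta_r\neq0\}$, with the vectors $$\mathbf l=\tfrac1{\Delta_r}\bigl((r^2+a^2)\partial_t+\Delta_r\partial_r+a\,\partial_\phi\bigr),\quad \mathbf k=\tfrac1{2\Sigma}\bigl((r^2+a^2)\partial_t-\Delta_r\partial_r+a\,\partial_\phi\bigr),\quad \mathbf m=\tfrac1{\sqrt2\,\varrho}\bigl(ia\sin\theta\,\partial_t+\partial_\theta+i\csc\theta\,\partial_\phi\bigr).$$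 Let $C_{\kappa\lambda\mu\nu}$ be the Weyl tensor (with $R^a{}_{bcd}=\partial_c\Gamma^a_{bd}-\partial_d\Gamma^a_{bc}+\Gamma^a_{ce}\Gamma^e_{bd}-\Gamma^a_{de}\Gamma^e_{bc}$) and $$\Psi_0=C(\mathbf l,\mathbf m,\mathbf l,\mathbf m),\ \Psi_1=C(\mathbf l,\mathbf k,\mathbf l,\mathbf m),\ \Psi_2=C(\mathbf l,\mathbf m,\bar{\mathbf m},\mathbf k),\ \Psi_3=C(\mathbf k,\mathbf l,\mathbf k,\bar{\mathbf m}),\ \Psi_4=C(\mathbf k,\bar{\mathbf m},\mathbf k,\bar{\mathbf m}).$$ A nonzero real null vector $n$ spans a principal null direction (PND) of $C$ if $n_{[e}C_{a]bc[d}n_{f]}n^bn^c=0$; the PND is double if $C_{abc[d}n_{e]}n^bn^c=0$ but not $C_{abc[d}n_{e]}n^c=0$. The Weyl tensor is of Petrov type D at a point if it has there exactly two PNDs, both double. Then: 1. At every point of $U$, $(\mathbf l,\mathbf k,\mathbf m,\bar{\mathbf m})$ is a null tetrad with $\mathbf l\cdot\mathbf k=-1$, $\mathbf m\cdot\bar{\mathbf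 m}=1$ and all other products zero; $\Psi_0=\Psi_1=\Psi_3=\Psi_4=0$; and $$\Psi_2=-\frac{6\varrho\,\mathcal M-2(r+\varrho)\bar\varrho\,\mathcal M'+r\bar\varrho^2\mathcal M''}{6\varrho\bar\varrho^3}.$$ 2. A point of $U$ is of Petrov type D if and only if $\Psi_2\neq0$ there, and in that case the two double principal null directions are those of $\mathbf l$ and $\mathbf k$, and there is no other principal null direction. 3. The set of points of $U$ with $\Psi_2\ne0$ is open, and its closure contains every point of $U$ with $\mathcal M(r)\neq0$. -/

import Mathlib

noncomputable section

namespace KerrLike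

/-! ### Curvature of a metric in a coordinate chart of a four-dimensional spacetime -/

/-- Points of the chart, and also coordinate components of real tangent vectors. -/
abbrev Pt : Type := Fin 4 → ℝ

/-- Components `T a b c d` of a covariant 4-tensor at a point. -/
abbrev Tensor4 : Type := Fin 4 → Fin 4 → Fin 4 → Fin 4 → ℝ

/-- The partial derivative `∂f/∂xⁱ` at `x`. -/
def pd (i : Fin 4) (f : Pt → ℝ) (x : Pt) : ℝ :=
  deriv (fun s : ℝ => f (Function.update x i s)) (x i)

/-- Christoffel symbols `Γᵃ_{bc}` of the Levi-Civita connection of the metric `g`. -/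
def christoffel (g : Pt → Matrix (Fin 4) (Fin 4) ℝ) (a b c : Fin 4) (x : Pt) : ℝ :=
  (1 / 2) * ∑ d, (g x)⁻¹ a d *
    (pd b (fun y => g y d c) x + pd c (fun y => g y d b) x - pd d (fun y => g y b c) x)

/-- Riemann tensor `Rᵃ_{bcd} = ∂_c Γᵃ_{bd} - ∂_d Γᵃ_{bc} + Γᵃ_{ce} Γᵉ_{bd} - Γᵃ_{de} Γᵉ_{bc}`. -/
def riemannUp (g : Pt → Matrix (Fin 4) (Fin 4) ℝ) (x : Pt) (a b c d : Fin 4) : ℝ :=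
  pd c (christoffel g a b d) x - pd d (christoffel g a b c) x
    + ∑ e, (christoffel g a c e x * christoffel g e b d x
      - christoffel g a d e x * christoffel g e b c x)

/-- Riemann tensor `R_{abcd}` with all indices lowered. -/
def riemann (g : Pt → Matrix (Fin 4) (Fin 4) ℝ) (x : Pt) : Tensor4 :=
  fun a b c d => ∑ e, g x a e * riemannUp g x e b c d

/-- Ricci tensor `R_{bd} = Rᵃ_{bad}`. -/
def ricci (g : Pt → Matrix (Fin 4) (Fin 4) ℝ) (x : Pt) (b d : Fin 4) : ℝ :=
  ∑ a, riemannUp g x a b a d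

/-- Curvature scalar. -/
def scalarCurv (g : Pt → Matrix (Fin 4) (Fin 4) ℝ) (x : Pt) : ℝ :=
  ∑ b, ∑ d, (g x)⁻¹ b d * ricci g x b d

/-- Weyl tensor `C_{abcd}` (dimension four). -/
def weyl (g : Pt → Matrix (Fin 4) (Fin 4) ℝ) (x : Pt) : Tensor4 :=
  fun a b c d =>
    riemann g x a b c d
      - (1 / 2) * (g x a c * ricci g x b d - g x a d * ricci g x b c
          - g x b c * ricci g x a d + g x b d * ricci g x a c)
      + scalarCurv g x / 6 * (g x a c * g x b d - g x a d * g x b c)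

/-! ### Principal null directions and Petrov type D, at a point -/

/-- Lowering an index: `n_a = g_{ab} nᵇ`. -/
def lower (g : Matrix (Fin 4) (Fin 4) ℝ) (n : Pt) (a : Fin 4) : ℝ := ∑ b, g a b * n b

/-- `n` is a nonzero real null vector. -/
def IsNullVec (g : Matrix (Fin 4) (Fin 4) ℝ) (n : Pt) : Prop :=
  n ≠ 0 ∧ ∑ a, ∑ b, g a b * n a * n b = 0

/-- `C_{abcd} nᵇ nᶜ`. -/
def contr2 (C : Tensor4) (n : Pt) (a d : Fin 4) : ℝ := ∑ b, ∑ c, C a b c d * n b * n c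

/-- `C_{abcd} nᶜ`. -/
def contr1 (C : Tensor4) (n : Pt) (a b d : Fin 4) : ℝ := ∑ c, C a b c d * n c

/-- The null vector `n` spans a principal null direction of `C` (of any multiplicity):
`n_{[e} C_{a]bc[d} n_{f]} nᵇ nᶜ = 0`. -/
def IsPND (g : Matrix (Fin 4) (Fin 4) ℝ) (C : Tensor4) (n : Pt) : Prop :=
  IsNullVec g n ∧ ∀ e a d f,
    lower g n e * contr2 C n a d * lower g n f - lower g n a * contr2 C n e d * lower g n f
      - lower g n e * contr2 C n a f * lower g n d
      + lower g n a * contr2 C n e f * lower g n d = 0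

/-- Multiplicity at least two: `C_{abc[d} n_{e]} nᵇ nᶜ = 0`. -/
def IsPNDGeTwo (g : Matrix (Fin 4) (Fin 4) ℝ) (C : Tensor4) (n : Pt) : Prop :=
  IsNullVec g n ∧ ∀ a d e,
    contr2 C n a d * lower g n e - contr2 C n a e * lower g n d = 0

/-- Multiplicity at least three: `C_{abc[d} n_{e]} nᶜ = 0`. -/
def IsPNDGeThree (g : Matrix (Fin 4) (Fin 4) ℝ) (C : Tensor4) (n : Pt) : Prop :=
  IsNullVec g n ∧ ∀ a b d e,
    contr1 C n a b d * lower g n e - contr1 C n a b e * lower g n d = 0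

/-- `n` spans a principal null direction of multiplicity exactly two. -/
def IsDoublePND (g : Matrix (Fin 4) (Fin 4) ℝ) (C : Tensor4) (n : Pt) : Prop :=
  IsPNDGeTwo g C n ∧ ¬ IsPNDGeThree g C n

/-- `n₁` and `n₂` span two different directions, both are double principal null directions
of `C`, and `C` has no other principal null direction. -/
def HasDoublePNDPair (g : Matrix (Fin 4) (Fin 4) ℝ) (C : Tensor4) (n₁ n₂ : Pt) : Prop :=
  LinearIndependent ℝ ![n₁, n₂] ∧ IsDoublePND g C n₁ ∧ IsDoublePND g C n₂ ∧
    ∀ n, IsPND g C n → ∃ c : ℝ, n = c • n₁ ∨ n = c • n₂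

/-- Petrov type D (the principal null directions coincide in two pairs). -/
def IsPetrovTypeD (g : Matrix (Fin 4) (Fin 4) ℝ) (C : Tensor4) : Prop :=
  ∃ n₁ n₂ : Pt, HasDoublePNDPair g C n₁ n₂

/-! ### Null tetrads and Newman–Penrose scalars -/

/-- Complexification of a real vector. -/
def toC (u : Pt) : Fin 4 → ℂ := fun i => (u i : ℂ)

/-- Componentwise complex conjugate. -/
def conjVec (u : Fin 4 → ℂ) : Fin 4 → ℂ := fun i => starRingEnd ℂ (u i)

/-- The complex-bilinear extension of the metric. -/
def dotC (g : Matrix (Fin 4) (Fin 4) ℝ) (u v : Fin 4 → ℂ) : ℂ :=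
  ∑ a, ∑ b, (g a b : ℂ) * u a * v b

/-- `(l, k, m, m̄)` is a null tetrad with `l·k = -1`, `m·m̄ = 1`, all other products zero. -/
def IsNullTetrad (g : Matrix (Fin 4) (Fin 4) ℝ) (l k : Pt) (m : Fin 4 → ℂ) : Prop :=
  dotC g (toC l) (toC l) = 0 ∧ dotC g (toC k) (toC k) = 0 ∧
  dotC g m m = 0 ∧ dotC g (conjVec m) (conjVec m) = 0 ∧
  dotC g (toC l) (toC k) = -1 ∧ dotC g m (conjVec m) = 1 ∧
  dotC g (toC l) m = 0 ∧ dotC g (toC l) (conjVec m) = 0 ∧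
  dotC g (toC k) m = 0 ∧ dotC g (toC k) (conjVec m) = 0

/-- `C_{abcd} uᵃ vᵇ wᶜ zᵈ`. -/
def contr4 (C : Tensor4) (u v w z : Fin 4 → ℂ) : ℂ :=
  ∑ a, ∑ b, ∑ c, ∑ d, (C a b c d : ℂ) * u a * v b * w c * z d

def Psi0 (C : Tensor4) (l : Pt) (m : Fin 4 → ℂ) : ℂ :=
  contr4 C (toC l) m (toC l) m

def Psi1 (C : Tensor4) (l k : Pt) (m : Fin 4 → ℂ) : ℂ :=
  contr4 C (toC l) (toC k) (toC l) m

def Psi2 (C : Tensor4) (l k : Pt) (m : Fin 4 → ℂ) : ℂ :=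
  contr4 C (toC l) m (conjVec m) (toC k)

def Psi3 (C : Tensor4) (l k : Pt) (m : Fin 4 → ℂ) : ℂ :=
  contr4 C (toC k) (toC l) (toC k) (conjVec m)

def Psi4 (C : Tensor4) (k : Pt) (m : Fin 4 → ℂ) : ℂ :=
  contr4 C (toC k) (conjVec m) (toC k) (conjVec m)

/-! ### The Kerr-like metric and its tetrad; coordinates `(x 0, x 1, x 2, x 3) = (t, r, θ, φ)` -/

/-- `Σ = r² + a² cos² θ`. -/
def Sig (a : ℝ) (x : Pt) : ℝ := x 1 ^ 2 + a ^ 2 * Real.cos (x 2) ^ 2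

/-- `Δ_r = r² - 2 M(r) r + a²`. -/
def Del (a : ℝ) (M : ℝ → ℝ) (x : Pt) : ℝ := x 1 ^ 2 - 2 * M (x 1) * x 1 + a ^ 2

/-- The 1-form `dt - a sin² θ dφ`. -/
def formT (a : ℝ) (x : Pt) : Fin 4 → ℝ := ![1, 0, 0, -(a * Real.sin (x 2) ^ 2)]

/-- The 1-form `dr`. -/
def formR : Fin 4 → ℝ := ![0, 1, 0, 0]

/-- The 1-form `dθ`. -/
def formTheta : Fin 4 → ℝ := ![0, 0, 1, 0]

/-- The 1-form `a dt - (r² + a²) dφ`. -/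
def formPhi (a : ℝ) (x : Pt) : Fin 4 → ℝ := ![a, 0, 0, -(x 1 ^ 2 + a ^ 2)]

/-- The Kerr-like metric. -/
def metric (a : ℝ) (M : ℝ → ℝ) (x : Pt) : Matrix (Fin 4) (Fin 4) ℝ :=
  Matrix.of fun i j =>
    -(Del a M x / Sig a x) * (formT a x i * formT a x j)
      + Sig a x / Del a M x * (formR i * formR j)
      + Sig a x * (formTheta i * formTheta j)
      + Real.sin (x 2) ^ 2 / Sig a x * (formPhi a x i * formPhi a x j)

/-- The part of the chart with `r ∈ I`, `0 < θ < π` on which the metric is defined. -/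
def domain (a : ℝ) (M : ℝ → ℝ) (I : Set ℝ) : Set Pt :=
  {x | x 1 ∈ I ∧ x 2 ∈ Set.Ioo 0 Real.pi ∧ Sig a x ≠ 0 ∧ Del a M x ≠ 0}

/-- `ϱ = r + i a cos θ`. -/
def rhoC (a : ℝ) (x : Pt) : ℂ := (x 1 : ℂ) + Complex.I * ((a * Real.cos (x 2) : ℝ) : ℂ)

/-- `ϱ̄ = r - i a cos θ`. -/
def rhoBar (a : ℝ) (x : Pt) : ℂ := (x 1 : ℂ) - Complex.I * ((a * Real.cos (x 2) : ℝ) : ℂ)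

def vecL (a : ℝ) (M : ℝ → ℝ) (x : Pt) : Pt :=
  (1 / Del a M x) • ![x 1 ^ 2 + a ^ 2, Del a M x, 0, a]

def vecK (a : ℝ) (M : ℝ → ℝ) (x : Pt) : Pt :=
  (1 / (2 * Sig a x)) • ![x 1 ^ 2 + a ^ 2, -Del a M x, 0, a]

def vecM (a : ℝ) (x : Pt) : Fin 4 → ℂ :=
  (1 / ((Real.sqrt 2 : ℂ) * rhoC a x)) •
    ![Complex.I * ((a * Real.sin (x 2) : ℝ) : ℂ), 0, 1, Complex.I * ((1 / Real.sin (x 2) : ℝ) : ℂ)]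

/-- `Ψ₂` of the Weyl tensor of the Kerr-like metric in its tetrad. -/
def kerrPsi2 (a : ℝ) (M : ℝ → ℝ) (x : Pt) : ℂ :=
  Psi2 (weyl (metric a M) x) (vecL a M x) (vecK a M x) (vecM a x)

end KerrLike

end

/-!
The metric is diagonal in the coframe `dt - a sin²θ dφ, dr, dθ, a dt - (r² + a²) dφ`, so metricity
and freeness of torsion determine its connection forms, and Cartan's second structure equation gives
the Riemann tensor. The latter is a type D tensor, built from the self-dual bivectors of the null
tetrad `(l, k, m, m̄)`, plus `(1/2) g ∧ P` (Kulkarni–Nomizu product) with `P` diagonal in the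
coframe. The type D tensor is trace-free and hence is the Weyl tensor; its only nonvanishing
Newman–Penrose scalar is its coefficient `Ψ₂`.

If `Ψ₂ ≠ 0` and `n` is principal, evaluating the tensor on `n` and on the vector
`(l·n) m - (m·n) l` orthogonal to `n` gives `(l·n) (m·n) = 0`, and with `n·n = 0` this makes `n`
a multiple of `l` or `k`. Where `r ≠ 0`, the numerator of `Ψ₂` cannot vanish at two points with the
same `r` and different values of `cos² θ` unless `M(r) = 0`; since `r` and `θ` may be varied, this
gives the density statement.
-/

noncomputable section

namespace KerrLike

open Matrix

open scoped ComplexConjugate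

/-- Real `4 × 4` matrices. -/
abbrev Mat : Type := Matrix (Fin 4) (Fin 4) ℝ

section MatrixCalculus

open scoped Matrix.Norms.Operator

variable {n : Type*} [Fintype n] {A : ℝ → Matrix n n ℝ} {A' : Matrix n n ℝ}
  {s : ℝ}

theorem hasDerivAt_matrix :
    HasDerivAt A A' s ↔ ∀ i j, HasDerivAt (fun t => A t i j) (A' i j) s := by
  refine ⟨fun h i j => ?_, fun h => ?_⟩
  · exact (entryLinearMap ℝ ℝ i j).toContinuousLinearMap.hasFDerivAt.comp_hasDerivAt s h
  · have hpi : HasDerivAt (fun t => (ofLinearEquiv ℝ).symm (A t)) ((ofLinearEquiv ℝ).symm A') s :=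
      hasDerivAt_pi.2 fun i => hasDerivAt_pi.2 (h i)
    exact (ofLinearEquiv ℝ).toContinuousLinearEquiv.hasFDerivAt.comp_hasDerivAt s hpi

theorem hasDerivAt_matrix_mul {B : ℝ → Matrix n n ℝ} {B' : Matrix n n ℝ} (hA : HasDerivAt A A' s)
    (hB : HasDerivAt B B' s) : HasDerivAt (fun t => A t * B t) (A' * B s + A s * B') s := by
  classical exact hA.mul hB

theorem hasDerivAt_matrix_inv [DecidableEq n] (hA : HasDerivAt A A' s) (hdet : (A s).det ≠ 0) :
    HasDerivAt (fun t => (A t)⁻¹) (-((A s)⁻¹ * A' * (A s)⁻¹)) s := by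
  obtain ⟨u, hu⟩ := (isUnit_iff_isUnit_det (A s)).2 hdet.isUnit
  have hinv := hasFDerivAt_ringInverse (𝕜 := ℝ) u
  rw [hu] at hinv
  have hcomp := hinv.comp_hasDerivAt s hA
  simp only [nonsing_inv_eq_ringInverse, ← hu, Ring.inverse_unit]
  exact hcomp

end MatrixCalculus

section PartialDerivative

variable {E : Type*} [AddCommGroup E] [Module ℝ E] [TopologicalSpace E] [ContinuousSMul ℝ E]

/-- `f'` is the partial derivative of `f` at `x` in the `i`-th coordinate direction; for scalar
functions this is `pd` together with differentiability. -/
def HasPd (i : Fin 4) (f : Pt → E) (f' : E) (x : Pt) : Prop :=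
  HasDerivAt (fun s : ℝ => f (Function.update x i s)) f' (x i)

variable {i : Fin 4} {x : Pt}

theorem HasPd.pd_eq {f : Pt → ℝ} {f' : ℝ} (h : HasPd i f f' x) : pd i f x = f' :=
  HasDerivAt.deriv h

theorem HasPd.congr_of_eventuallyEq {f₁ f : Pt → ℝ} {f' : ℝ} (h : HasPd i f f' x)
    (heq : f₁ =ᶠ[nhds x] f) : HasPd i f₁ f' x := by
  have hline : Filter.Tendsto (fun s : ℝ => Function.update x i s) (nhds (x i)) (nhds x) := by
    have hcont : Continuous fun s : ℝ => Function.update x i s := by fun_prop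
    simpa only [Function.update_eq_self] using hcont.tendsto (x i)
  exact HasDerivAt.congr_of_eventuallyEq h (hline.eventually heq)

section Scalar

variable {f f₁ : Pt → ℝ} {f' f₁' : ℝ}

theorem hasPd_const (r : ℝ) : HasPd i (fun _ => r) 0 x :=
  hasDerivAt_const _ r

theorem HasPd.congr_deriv (hf : HasPd i f f' x) (h : f' = f₁') : HasPd i f f₁' x :=
  h ▸ hf

theorem HasPd.comp_of_hasDerivAt {φ : ℝ → ℝ} {φ' : ℝ} (hφ : HasDerivAt φ φ' (f x))
    (hf : HasPd i f f' x) : HasPd i (fun y => φ (f y)) (φ' * f') x :=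
  HasDerivAt.comp (x i) (by rwa [Function.update_eq_self]) hf

theorem HasPd.add (hf : HasPd i f f' x) (hf₁ : HasPd i f₁ f₁' x) :
    HasPd i (fun y => f y + f₁ y) (f' + f₁') x :=
  HasDerivAt.fun_add hf hf₁

theorem HasPd.sub (hf : HasPd i f f' x) (hf₁ : HasPd i f₁ f₁' x) :
    HasPd i (fun y => f y - f₁ y) (f' - f₁') x :=
  HasDerivAt.fun_sub hf hf₁

theorem HasPd.neg (hf : HasPd i f f' x) : HasPd i (fun y => -f y) (-f') x :=
  HasDerivAt.fun_neg hf

theorem HasPd.const_mul (r : ℝ) (hf : HasPd i f f' x) : HasPd i (fun y => r * f y) (r * f') x :=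
  HasDerivAt.const_mul r hf

theorem HasPd.mul (hf : HasPd i f f' x) (hf₁ : HasPd i f₁ f₁' x) :
    HasPd i (fun y => f y * f₁ y) (f' * f₁ x + f x * f₁') x := by
  simpa only [HasPd, Function.update_eq_self] using HasDerivAt.fun_mul hf hf₁

theorem HasPd.sq (hf : HasPd i f f' x) : HasPd i (fun y => f y ^ 2) (2 * f x * f') x := by
  simpa only [pow_two, two_mul, add_mul, mul_comm f'] using hf.mul hf

theorem HasPd.div (hf : HasPd i f f' x) (hf₁ : HasPd i f₁ f₁' x) (hx : f₁ x ≠ 0) :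
    HasPd i (fun y => f y / f₁ y) ((f' * f₁ x - f x * f₁') / f₁ x ^ 2) x := by
  have hx' : f₁ (Function.update x i (x i)) ≠ 0 := by rwa [Function.update_eq_self]
  simpa only [HasPd, Function.update_eq_self] using HasDerivAt.fun_div hf hf₁ hx'

end Scalar

variable {A B : Pt → Mat} {A' B' : Mat}

theorem hasPd_matrix : HasPd i A A' x ↔ ∀ j k, HasPd i (fun y => A y j k) (A' j k) x :=
  hasDerivAt_matrix

theorem HasPd.matrix_transpose (hA : HasPd i A A' x) : HasPd i (fun y => (A y)ᵀ) A'ᵀ x :=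
  hasPd_matrix.2 fun j k => hasPd_matrix.1 hA k j

theorem HasPd.matrix_add (hA : HasPd i A A' x) (hB : HasPd i B B' x) :
    HasPd i (fun y => A y + B y) (A' + B') x :=
  hasPd_matrix.2 fun j k => (hasPd_matrix.1 hA j k).fun_add (hasPd_matrix.1 hB j k)

theorem HasPd.matrix_mul (hA : HasPd i A A' x) (hB : HasPd i B B' x) :
    HasPd i (fun y => A y * B y) (A' * B x + A x * B') x := by
  simpa only [HasPd, Function.update_eq_self] using hasDerivAt_matrix_mul hA hB

theorem HasPd.matrix_inv (hA : HasPd i A A' x) (hdet : (A x).det ≠ 0) :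
    HasPd i (fun y => (A y)⁻¹) (-((A x)⁻¹ * A' * (A x)⁻¹)) x := by
  have hdet' : (A (Function.update x i (x i))).det ≠ 0 := by rwa [Function.update_eq_self]
  simpa only [HasPd, Function.update_eq_self] using hasDerivAt_matrix_inv hA hdet'

theorem hasPd_fderiv {f : Pt → ℝ} (hf : DifferentiableAt ℝ f x) :
    HasPd i f (fderiv ℝ f x (Pi.single i 1)) x := by
  refine HasFDerivAt.comp_hasDerivAt (f := Function.update x i) (x i) ?_
    (hasDerivAt_update x i (x i))
  rw [Function.update_eq_self]
  exact hf.hasFDerivAt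

theorem hasPd_pd {f : Pt → ℝ} (hf : ContDiffAt ℝ 2 f x) (c d : Fin 4) :
    HasPd c (pd d f) (fderiv ℝ (fderiv ℝ f) x (Pi.single c 1) (Pi.single d 1)) x := by
  have hpd : pd d f =ᶠ[nhds x] fun y => fderiv ℝ f y (Pi.single d 1) := by
    filter_upwards [hf.eventually (by simp)] with y hy
    exact (hasPd_fderiv (hy.differentiableAt (by norm_num))).pd_eq
  have hdiff : DifferentiableAt ℝ (fderiv ℝ f) x :=
    (hf.fderiv_right (m := 1) (by norm_num)).differentiableAt (by norm_num)
  have h := hasPd_fderiv (i := c) (hdiff.clm_apply (differentiableAt_const (Pi.single d (1 : ℝ))))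
  rw [fderiv_clm_apply hdiff (differentiableAt_const _)] at h
  simpa using h.congr_of_eventuallyEq hpd

theorem exists_symmetric_hasPd_hasPd {U : Set Pt} (hU : IsOpen U) {A₁ : Fin 4 → Pt → Mat}
    (hA : ∀ j k, ContDiffOn ℝ 2 (fun y => A y j k) U) (hA₁ : ∀ y ∈ U, ∀ c, HasPd c A (A₁ c y) y)
    (hx : x ∈ U) :
    ∃ A₂ : Fin 4 → Fin 4 → Mat, (∀ c d, A₂ c d = A₂ d c) ∧ ∀ c d, HasPd c (A₁ d) (A₂ c d) x := by
  have hA_at : ∀ j k, ContDiffAt ℝ 2 (fun y => A y j k) x := fun j k =>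
    (hA j k).contDiffAt (hU.mem_nhds hx)
  refine ⟨fun c d => of fun j k =>
    fderiv ℝ (fderiv ℝ fun y => A y j k) x (Pi.single c 1) (Pi.single d 1), fun c d => ?_,
    fun c d => hasPd_matrix.2 fun j k => (hasPd_pd (hA_at j k) c d).congr_of_eventuallyEq ?_⟩
  · ext j k
    exact (hA_at j k).isSymmSndFDerivAt (by simp) _ _
  · filter_upwards [hU.mem_nhds hx] with y hy
    exact (hasPd_matrix.1 (hA₁ y hy d) j k).pd_eq.symm

end PartialDerivative

section LeviCivita

/-- The matrices `L c`, with entries `(L c) a b = Γ_{abc}`, are the Christoffel symbols of the first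
kind of the metric `g` on `U`: the second equation is metricity, the third freeness of torsion. -/
structure IsLeviCivita (g : Pt → Mat) (L : Fin 4 → Pt → Mat) (U : Set Pt) : Prop where
  det_ne_zero : ∀ x ∈ U, (g x).det ≠ 0
  hasPd_metric : ∀ x ∈ U, ∀ c, HasPd c g (L c x + (L c x)ᵀ) x
  symm : ∀ x ∈ U, ∀ a b c, L c x a b = L b x a c

namespace IsLeviCivita

variable {g : Pt → Mat} {L : Fin 4 → Pt → Mat} {U : Set Pt} {x : Pt}

theorem mul_symm (h : IsLeviCivita g L U) (hx : x ∈ U) (A : Mat) (a b c : Fin 4) :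
    (A * L c x) a b = (A * L b x) a c := by
  simp only [mul_apply, h.symm x hx _ b c]

theorem christoffel_eq (h : IsLeviCivita g L U) (hx : x ∈ U) (a b c : Fin 4) :
    christoffel g a b c x = ((g x)⁻¹ * L c x) a b := by
  have hpd : ∀ c i j, pd c (fun y => g y i j) x = L c x i j + L c x j i := fun c i j =>
    (hasPd_matrix.1 (h.hasPd_metric x hx c) i j).pd_eq
  rw [christoffel, mul_apply, Finset.mul_sum]
  refine Finset.sum_congr rfl fun d _ => ?_
  rw [hpd, hpd, hpd, h.symm x hx d c b, h.symm x hx c d b, h.symm x hx b d c]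
  ring

theorem pd_christoffel (h : IsLeviCivita g L U) (hU : IsOpen U) (hx : x ∈ U) {c d : Fin 4}
    {L' : Mat} (hL : HasPd c (L d) L' x) (a b : Fin 4) :
    pd c (christoffel g a b d) x =
      ((g x)⁻¹ * L' - (g x)⁻¹ * (L c x + (L c x)ᵀ) * (g x)⁻¹ * L d x) a b := by
  have hprod := ((h.hasPd_metric x hx c).matrix_inv (h.det_ne_zero x hx)).matrix_mul hL
  have heq : christoffel g a b d =ᶠ[nhds x] fun y => ((g y)⁻¹ * L d y) a b := by
    filter_upwards [hU.mem_nhds hx] with y hy using h.christoffel_eq hy a b d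
  rw [((hasPd_matrix.1 hprod a b).congr_of_eventuallyEq heq).pd_eq]
  refine congrFun (congrFun ?_ a) b
  noncomm_ring

theorem riemannUp_eq (h : IsLeviCivita g L U) (hU : IsOpen U) (hx : x ∈ U)
    {L' : Fin 4 → Fin 4 → Mat} (hL : ∀ c d, HasPd c (L d) (L' c d) x) (a b c d : Fin 4) :
    riemannUp g x a b c d = ((g x)⁻¹ * (L' c d - L' d c - (L c x)ᵀ * (g x)⁻¹ * L d x
      + (L d x)ᵀ * (g x)⁻¹ * L c x)) a b := by
  have hquad : ∑ e, (christoffel g a c e x * christoffel g e b d x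
      - christoffel g a d e x * christoffel g e b c x) =
        ((g x)⁻¹ * L c x * ((g x)⁻¹ * L d x) - (g x)⁻¹ * L d x * ((g x)⁻¹ * L c x)) a b := by
    simp only [h.christoffel_eq hx, h.mul_symm hx _ a c, h.mul_symm hx _ a d, Matrix.sub_apply,
      mul_apply (M := (g x)⁻¹ * L _ x), Finset.sum_sub_distrib]
  rw [riemannUp, hquad, h.pd_christoffel hU hx (hL c d), h.pd_christoffel hU hx (hL d c),
    ← Matrix.sub_apply, ← Matrix.add_apply]
  refine congrFun (congrFun ?_ a) b
  noncomm_ring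

theorem riemann_eq (h : IsLeviCivita g L U) (hU : IsOpen U) (hx : x ∈ U)
    {L' : Fin 4 → Fin 4 → Mat} (hL : ∀ c d, HasPd c (L d) (L' c d) x) (a b c d : Fin 4) :
    riemann g x a b c d = (L' c d - L' d c - (L c x)ᵀ * (g x)⁻¹ * L d x
      + (L d x)ᵀ * (g x)⁻¹ * L c x) a b := by
  simp only [riemann, h.riemannUp_eq hU hx hL]
  rw [← mul_apply, mul_nonsing_inv_cancel_left _ _ (h.det_ne_zero x hx).isUnit]

end IsLeviCivita

/-- The matrices `α c` are the components of the Levi-Civita connection, with frame indices lowered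
by `h`, in the coframe given by the rows of `Θ`, for the metric `Θᵀ * h * Θ` on `U`. The matrices
`Θ' c` are the partial derivatives of `Θ`; the last two equations are metricity and freeness of
torsion. -/
structure IsCoframeConnection (Θ h : Pt → Mat) (Θ' α : Fin 4 → Pt → Mat) (U : Set Pt) : Prop where
  det_coframe_ne_zero : ∀ x ∈ U, (Θ x).det ≠ 0
  det_frameMetric_ne_zero : ∀ x ∈ U, (h x).det ≠ 0
  frameMetric_symm : ∀ x ∈ U, (h x)ᵀ = h x
  hasPd_coframe : ∀ x ∈ U, ∀ c, HasPd c Θ (Θ' c x) x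
  hasPd_frameMetric : ∀ x ∈ U, ∀ c, HasPd c h (α c x + (α c x)ᵀ) x
  torsionFree : ∀ x ∈ U, ∀ i b c,
    (h x * Θ' c x + α c x * Θ x) i b = (h x * Θ' b x + α b x * Θ x) i c

namespace IsCoframeConnection

variable {Θ h : Pt → Mat} {Θ' α : Fin 4 → Pt → Mat} {U : Set Pt} {x : Pt}

theorem isLeviCivita (hα : IsCoframeConnection Θ h Θ' α U) :
    IsLeviCivita (fun y => (Θ y)ᵀ * h y * Θ y)
      (fun c y => (Θ y)ᵀ * (h y * Θ' c y + α c y * Θ y)) U where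
  det_ne_zero x hx := by
    rw [det_mul, det_mul, det_transpose]
    exact mul_ne_zero (mul_ne_zero (hα.det_coframe_ne_zero x hx)
      (hα.det_frameMetric_ne_zero x hx)) (hα.det_coframe_ne_zero x hx)
  hasPd_metric x hx c := by
    have hΘ := hα.hasPd_coframe x hx c
    convert (hΘ.matrix_transpose.matrix_mul (hα.hasPd_frameMetric x hx c)).matrix_mul hΘ using 1
    simp only [transpose_mul, transpose_add, transpose_transpose, hα.frameMetric_symm x hx]
    noncomm_ring
  symm x hx a b c := by
    simp only [mul_apply (M := (Θ x)ᵀ), hα.torsionFree x hx _ b c]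

theorem transpose_mul_inv_mul (hα : IsCoframeConnection Θ h Θ' α U) (hx : x ∈ U) (c d : Fin 4) :
    ((Θ x)ᵀ * (h x * Θ' c x + α c x * Θ x))ᵀ * ((Θ x)ᵀ * h x * Θ x)⁻¹
        * ((Θ x)ᵀ * (h x * Θ' d x + α d x * Θ x)) =
      (Θ' c x)ᵀ * h x * Θ' d x + (Θ' c x)ᵀ * α d x * Θ x + (Θ x)ᵀ * (α c x)ᵀ * Θ' d x
        + (Θ x)ᵀ * (α c x)ᵀ * (h x)⁻¹ * α d x * Θ x := by
  have hΘ : IsUnit (Θ x).det := (hα.det_coframe_ne_zero x hx).isUnit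
  have hh : IsUnit (h x).det := (hα.det_frameMetric_ne_zero x hx).isUnit
  have hΘT : IsUnit (Θ x)ᵀ.det := by rwa [det_transpose]
  calc _ = (h x * Θ' c x + α c x * Θ x)ᵀ * (h x)⁻¹ * (h x * Θ' d x + α d x * Θ x) := by
        rw [transpose_mul, transpose_transpose, Matrix.mul_inv_rev, Matrix.mul_inv_rev]
        simp only [Matrix.mul_assoc, mul_nonsing_inv_cancel_left _ _ hΘ,
          nonsing_inv_mul_cancel_left _ _ hΘT]
    _ = (Θ' c x)ᵀ * (h x * ((h x)⁻¹ * (h x * Θ' d x)))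
          + (Θ' c x)ᵀ * (h x * ((h x)⁻¹ * (α d x * Θ x)))
          + (Θ x)ᵀ * (α c x)ᵀ * ((h x)⁻¹ * (h x * Θ' d x))
          + (Θ x)ᵀ * (α c x)ᵀ * (h x)⁻¹ * α d x * Θ x := by
        rw [transpose_add, transpose_mul, transpose_mul, hα.frameMetric_symm x hx]
        noncomm_ring
    _ = _ := by
        simp only [nonsing_inv_mul_cancel_left _ _ hh, mul_nonsing_inv_cancel_left _ _ hh,
          Matrix.mul_assoc]

/-- Cartan's second structure equation. -/
theorem riemann_eq (hα : IsCoframeConnection Θ h Θ' α U) (hU : IsOpen U)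
    (hΘ : ∀ i j, ContDiffOn ℝ 2 (fun y => Θ y i j) U) (hx : x ∈ U) {α' : Fin 4 → Fin 4 → Mat}
    (hα' : ∀ c d, HasPd c (α d) (α' c d) x) (a b c d : Fin 4) :
    riemann (fun y => (Θ y)ᵀ * h y * Θ y) x a b c d =
      ((Θ x)ᵀ * (α' c d - α' d c - (α c x)ᵀ * (h x)⁻¹ * α d x
        + (α d x)ᵀ * (h x)⁻¹ * α c x) * Θ x) a b := by
  obtain ⟨Θ'', hΘ''_symm, hΘ''⟩ := exists_symmetric_hasPd_hasPd hU hΘ hα.hasPd_coframe hx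
  have hL := fun c d => (hα.hasPd_coframe x hx c).matrix_transpose.matrix_mul
    (((hα.hasPd_frameMetric x hx c).matrix_mul (hΘ'' c d)).matrix_add
      ((hα' c d).matrix_mul (hα.hasPd_coframe x hx c)))
  rw [hα.isLeviCivita.riemann_eq hU hx hL]
  simp only [hα.transpose_mul_inv_mul hx]
  rw [hΘ''_symm d c]
  refine congrFun (congrFun ?_ a) b
  noncomm_ring

end IsCoframeConnection

end LeviCivita

section TraceFreePart

/-- The Kulkarni–Nomizu product of two bilinear forms. -/
def kulkarniNomizu (P Q : Mat) : Tensor4 := fun a b c d =>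
  P a c * Q b d - P a d * Q b c - P b c * Q a d + P b d * Q a c

/-- The Ricci-type trace `Jᵃᶜ T_{cbad}` of a 4-tensor. -/
def ricciTrace (J : Mat) (T : Tensor4) : Mat :=
  of fun b d => ∑ a, ∑ c, J a c * T c b a d

theorem ricciTrace_add (J : Mat) (T T' : Tensor4) :
    ricciTrace J (T + T') = ricciTrace J T + ricciTrace J T' := by
  ext b d
  simp only [ricciTrace, of_apply, Matrix.add_apply, Pi.add_apply, mul_add, Finset.sum_add_distrib]

theorem ricciTrace_smul (J : Mat) (r : ℝ) (T : Tensor4) :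
    ricciTrace J (r • T) = r • ricciTrace J T := by
  ext b d
  simp only [ricciTrace, of_apply, Matrix.smul_apply, Pi.smul_apply, smul_eq_mul, Finset.mul_sum,
    mul_left_comm]

theorem ricciTrace_kulkarniNomizu (J P Q : Mat) :
    ricciTrace J (kulkarniNomizu P Q) =
      trace (J * P) • Q - Q * J * P - P * J * Q + trace (J * Q) • P := by
  ext b d
  simp only [ricciTrace, kulkarniNomizu, of_apply, trace, diag_apply, Matrix.sub_apply,
    Matrix.add_apply, Matrix.smul_apply, smul_eq_mul, mul_apply, Fin.sum_univ_four]
  ring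

theorem ricci_eq_ricciTrace {g : Pt → Mat} {x : Pt} (hdet : (g x).det ≠ 0) :
    of (ricci g x) = ricciTrace (g x)⁻¹ (riemann g x) := by
  ext b d
  have hraise : ∀ a, riemannUp g x a b a d = ∑ c, (g x)⁻¹ a c * riemann g x c b a d := by
    intro a
    have h := congrFun (congrFun (nonsing_inv_mul_cancel_left (g x)
      (of fun e _ : Fin 4 => riemannUp g x e b a d) hdet.isUnit).symm a) 0
    simpa only [of_apply, mul_apply, riemann] using h
  simp only [of_apply, ricci, ricciTrace, hraise]

theorem ricciTrace_inv_kulkarniNomizu {g : Mat} (hdet : g.det ≠ 0) (P : Mat) :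
    ricciTrace g⁻¹ (kulkarniNomizu g P) = (2 : ℝ) • P + trace (g⁻¹ * P) • g := by
  have hinv : g⁻¹ * g = 1 := nonsing_inv_mul g hdet.isUnit
  have hinv' : g * g⁻¹ = 1 := mul_nonsing_inv g hdet.isUnit
  rw [ricciTrace_kulkarniNomizu, hinv, hinv', Matrix.mul_assoc, hinv, trace_one, Matrix.one_mul,
    Matrix.mul_one, Fintype.card_fin]
  module

theorem weyl_eq_of_riemann_eq {g : Pt → Mat} {x : Pt} (hdet : (g x).det ≠ 0)
    (hsymm : (g x)ᵀ = g x) {W : Tensor4} {P : Mat}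
    (hR : riemann g x = W + (1 / 2 : ℝ) • kulkarniNomizu (g x) P)
    (hW : ricciTrace (g x)⁻¹ W = 0) : weyl g x = W := by
  set t : ℝ := trace ((g x)⁻¹ * P) with ht
  have hricci : of (ricci g x) = P + (t / 2) • g x := by
    rw [ricci_eq_ricciTrace hdet, hR, ricciTrace_add, ricciTrace_smul, hW,
      ricciTrace_inv_kulkarniNomizu hdet, ← ht]
    module
  have hscalar : scalarCurv g x = 3 * t := by
    have hinv : ((g x)⁻¹)ᵀ = (g x)⁻¹ := by rw [transpose_nonsing_inv, hsymm]
    calc scalarCurv g x = trace ((g x)⁻¹ * (of (ricci g x))ᵀ) := by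
          simp only [scalarCurv, trace, diag_apply, mul_apply, transpose_apply, of_apply]
      _ = trace ((g x)⁻¹ * of (ricci g x)) := by
          rw [← trace_transpose, transpose_mul, transpose_transpose, hinv, trace_mul_comm]
      _ = t + t / 2 * trace ((g x)⁻¹ * g x) := by
          rw [hricci, Matrix.mul_add, Matrix.mul_smul, trace_add, trace_smul, smul_eq_mul]
      _ = 3 * t := by
          rw [nonsing_inv_mul _ hdet.isUnit, trace_one, Fintype.card_fin]
          ring
  have hricci_apply : ∀ a b, ricci g x a b = P a b + t / 2 * g x a b := fun a b =>
    congrFun (congrFun hricci a) b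
  funext a b c d
  simp only [weyl, hR, hricci_apply, hscalar, kulkarniNomizu, Pi.add_apply, Pi.smul_apply,
    smul_eq_mul]
  ring

end TraceFreePart

section NullTetrad

variable {g : Mat} {l k n : Pt} {m : Fin 4 → ℂ}

theorem conjVec_conjVec (u : Fin 4 → ℂ) : conjVec (conjVec u) = u :=
  funext fun _ => Complex.conj_conj _

theorem conjVec_toC (u : Pt) : conjVec (toC u) = toC u :=
  funext fun _ => Complex.conj_ofReal _

theorem conjVec_single (a : Fin 4) : conjVec (Pi.single a 1) = Pi.single a 1 := by
  funext i
  rcases eq_or_ne i a with rfl | h <;> simp [conjVec, *]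

theorem conj_dotC (g : Mat) (u v : Fin 4 → ℂ) :
    conj (dotC g u v) = dotC g (conjVec u) (conjVec v) := by
  simp only [dotC, conjVec, map_sum, map_mul, Complex.conj_ofReal]

theorem dotC_comm (hg : gᵀ = g) (u v : Fin 4 → ℂ) : dotC g u v = dotC g v u := by
  have hentry : ∀ a b, g a b = g b a := fun a b => congrFun (congrFun hg.symm a) b
  rw [dotC, Finset.sum_comm]
  exact Finset.sum_congr rfl fun a _ => Finset.sum_congr rfl fun b _ => by rw [hentry b a]; ring

theorem dotC_eq_dotProduct (g : Mat) (u v : Fin 4 → ℂ) :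
    dotC g u v = u ⬝ᵥ (g.map Complex.ofReal *ᵥ v) := by
  simp only [dotC, dotProduct, mulVec, map_apply, Finset.mul_sum]
  exact Finset.sum_congr rfl fun a _ => Finset.sum_congr rfl fun b _ => by ring

theorem dotC_sub_right (g : Mat) (u v w : Fin 4 → ℂ) :
    dotC g u (v - w) = dotC g u v - dotC g u w := by
  simp only [dotC_eq_dotProduct, mulVec_sub, dotProduct_sub]

theorem dotC_smul_right (g : Mat) (c : ℂ) (u v : Fin 4 → ℂ) :
    dotC g u (c • v) = c * dotC g u v := by
  simp only [dotC_eq_dotProduct, mulVec_smul, dotProduct_smul, smul_eq_mul]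

theorem sum_dotC_single_mul (g : Mat) (u v : Fin 4 → ℂ) :
    ∑ a, dotC g u (Pi.single a 1) * v a = dotC g u v := by
  simp only [dotC_eq_dotProduct, dotProduct_mulVec, dotProduct_single, mul_one]
  rfl

theorem ofReal_lower (hg : gᵀ = g) (n : Pt) (a : Fin 4) :
    (lower g n a : ℂ) = dotC g (toC n) (Pi.single a 1) := by
  rw [dotC_comm hg, dotC_eq_dotProduct, single_one_dotProduct]
  simp [lower, mulVec, dotProduct, toC]

theorem isNullVec_iff (hn : n ≠ 0) : IsNullVec g n ↔ dotC g (toC n) (toC n) = 0 := by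
  have hcast : dotC g (toC n) (toC n) = ((∑ a, ∑ b, g a b * n a * n b : ℝ) : ℂ) := by
    simp only [dotC, toC, Complex.ofReal_sum, Complex.ofReal_mul]
  rw [IsNullVec, and_iff_right hn, hcast, Complex.ofReal_eq_zero]

namespace IsNullTetrad

theorem products (hg : gᵀ = g) (h : IsNullTetrad g l k m) :
    (dotC g (toC l) (toC l) = 0 ∧ dotC g (toC l) (toC k) = -1 ∧
      dotC g (toC l) m = 0 ∧ dotC g (toC l) (conjVec m) = 0) ∧
    (dotC g (toC k) (toC l) = -1 ∧ dotC g (toC k) (toC k) = 0 ∧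
      dotC g (toC k) m = 0 ∧ dotC g (toC k) (conjVec m) = 0) ∧
    (dotC g m (toC l) = 0 ∧ dotC g m (toC k) = 0 ∧
      dotC g m m = 0 ∧ dotC g m (conjVec m) = 1) ∧
    (dotC g (conjVec m) (toC l) = 0 ∧ dotC g (conjVec m) (toC k) = 0 ∧
      dotC g (conjVec m) m = 1 ∧ dotC g (conjVec m) (conjVec m) = 0) := by
  obtain ⟨hll, hkk, hmm, hnn, hlk, hmn, hlm, hln, hkm, hkn⟩ := h
  rw [dotC_comm hg (toC k) (toC l), dotC_comm hg m (toC l), dotC_comm hg m (toC k),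
    dotC_comm hg (conjVec m) (toC l), dotC_comm hg (conjVec m) (toC k),
    dotC_comm hg (conjVec m) m]
  exact ⟨⟨hll, hlk, hlm, hln⟩, ⟨hlk, hkk, hkm, hkn⟩, ⟨hlm, hkm, hmm, hmn⟩, hln, hkn, hmn, hnn⟩

theorem swap (hg : gᵀ = g) (h : IsNullTetrad g l k m) : IsNullTetrad g k l (conjVec m) := by
  simp only [IsNullTetrad, conjVec_conjVec, h.products hg, and_self]

theorem inverseMetric_mul (hg : gᵀ = g) (h : IsNullTetrad g l k m) :
    (vecMulVec m (conjVec m) + vecMulVec (conjVec m) m - vecMulVec (toC l) (toC k)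
      - vecMulVec (toC k) (toC l)) * g.map Complex.ofReal = 1 := by
  set e : Fin 4 → Fin 4 → ℂ := ![toC l, toC k, m, conjVec m] with he
  set η : Matrix (Fin 4) (Fin 4) ℂ := !![0, -1, 0, 0; -1, 0, 0, 0; 0, 0, 0, 1; 0, 0, 1, 0] with hη
  have hgram : of e * g.map Complex.ofReal * (of e)ᵀ = η := by
    ext i j
    have hentry : (of e * g.map Complex.ofReal * (of e)ᵀ) i j = dotC g (e i) (e j) := by
      rw [Matrix.mul_assoc, dotC_eq_dotProduct]
      rfl
    rw [hentry]
    fin_cases i <;> fin_cases j <;> simp [e, η, h.products hg]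
  have hηη : η * η = 1 := by
    ext i j
    fin_cases i <;> fin_cases j <;> simp [η, mul_apply, Fin.sum_univ_four]
  have hleft : (of e)ᵀ * (η * (of e * g.map Complex.ofReal)) = 1 := by
    rw [mul_eq_one_comm, Matrix.mul_assoc, hgram, hηη]
  rw [← hleft, ← Matrix.mul_assoc, ← Matrix.mul_assoc]
  congr 1
  ext i j
  simp only [Matrix.sub_apply, Matrix.add_apply, vecMulVec_apply, he, hη, mul_apply,
    transpose_apply, of_apply, cons_val', cons_val_fin_one, Fin.sum_univ_four, cons_val_zero,
    cons_val_one, cons_val, mul_zero, mul_neg, mul_one, zero_add, add_zero, neg_mul]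
  ring

theorem eq_sum (hg : gᵀ = g) (h : IsNullTetrad g l k m) (u : Fin 4 → ℂ) :
    u = dotC g (conjVec m) u • m + dotC g m u • conjVec m - dotC g (toC k) u • toC l
      - dotC g (toC l) u • toC k := by
  conv_lhs => rw [← one_mulVec u, ← h.inverseMetric_mul hg, ← mulVec_mulVec]
  simp only [sub_mulVec, add_mulVec, vecMulVec_mulVec, dotC_eq_dotProduct, op_smul_eq_smul]

theorem ofReal_inv_apply (hg : gᵀ = g) (h : IsNullTetrad g l k m) (a c : Fin 4) :
    ((g⁻¹ a c : ℝ) : ℂ) = m a * conjVec m c + conjVec m a * m c - toC l a * toC k c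
      - toC k a * toC l c := by
  have hleft := h.inverseMetric_mul hg
  have hdet : g.det ≠ 0 := fun h0 => det_ne_zero_of_left_inverse hleft <|
    (Complex.ofRealHom.map_det g).symm.trans (by rw [h0, map_zero])
  have hinv : g⁻¹.map Complex.ofReal * g.map Complex.ofReal = 1 := by
    have hmap := Matrix.map_mul (L := g⁻¹) (M := g) (f := Complex.ofRealHom)
    rw [nonsing_inv_mul g hdet.isUnit, Matrix.map_one _ (map_zero _) (map_one _)] at hmap
    exact hmap.symm
  have huniq := (inv_eq_left_inv hinv).symm.trans (inv_eq_left_inv hleft)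
  simpa [vecMulVec_apply] using congrFun (congrFun huniq a) c

end IsNullTetrad

end NullTetrad

section TypeD

variable {g : Mat} {l k n : Pt} {m : Fin 4 → ℂ} {Ψ : ℂ} {C : Tensor4}

theorem ofReal_contr2 (C : Tensor4) (n : Pt) (a d : Fin 4) :
    (contr2 C n a d : ℂ) = contr4 C (Pi.single a 1) (toC n) (toC n) (Pi.single d 1) := by
  simp [contr4, contr2, toC, Pi.single_apply]

theorem contr4_eq_sum_contr2 (C : Tensor4) (n : Pt) (u v : Fin 4 → ℂ) :
    contr4 C u (toC n) (toC n) v = ∑ a, ∑ d, (contr2 C n a d : ℂ) * (u a * v d) := by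
  simp only [contr4, contr2, toC, Complex.ofReal_sum, Finset.sum_mul]
  refine Finset.sum_congr rfl fun a _ => ?_
  rw [Finset.sum_comm_cycle]
  refine Finset.sum_congr rfl fun d _ => Finset.sum_congr rfl fun b _ =>
    Finset.sum_congr rfl fun c _ => ?_
  push_cast
  ring

theorem contr4_eq_sum_contr1 (C : Tensor4) (n : Pt) (u v w : Fin 4 → ℂ) :
    contr4 C u v (toC n) w = ∑ a, ∑ b, (∑ d, (contr1 C n a b d : ℂ) * w d) * (u a * v b) := by
  simp only [contr4, contr1, toC, Complex.ofReal_sum, Finset.sum_mul]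
  refine Finset.sum_congr rfl fun a _ => Finset.sum_congr rfl fun b _ => ?_
  rw [Finset.sum_comm]
  refine Finset.sum_congr rfl fun d _ => Finset.sum_congr rfl fun c _ => ?_
  push_cast
  ring

theorem exists_lower_ne_zero (hg : gᵀ = g) {w : Fin 4 → ℂ} (hw : dotC g (toC n) w ≠ 0) :
    ∃ e, lower g n e ≠ 0 := by
  by_contra! h
  refine hw ?_
  rw [← sum_dotC_single_mul]
  simp [← ofReal_lower hg, h]

theorem IsPND.contr4_eq_zero (hg : gᵀ = g) (h : IsPND g C n) {u w : Fin 4 → ℂ}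
    (hu : dotC g (toC n) u = 0) (hw : dotC g (toC n) w ≠ 0) :
    contr4 C u (toC n) (toC n) u = 0 := by
  obtain ⟨e, he⟩ := exists_lower_ne_zero hg hw
  have he' : (lower g n e : ℂ) ≠ 0 := by exact_mod_cast he
  simp only [← sum_dotC_single_mul g (toC n) u, ← ofReal_lower hg] at hu
  have hpt : ∀ a d, (lower g n e : ℂ) ^ 2 * ((contr2 C n a d : ℂ) * (u a * u d)) =
      (lower g n a * u a) * (lower g n e * contr2 C n e d * u d)
        + (lower g n e * contr2 C n a e * u a) * (lower g n d * u d)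
        - (lower g n a * u a) * (contr2 C n e e * (lower g n d * u d)) := by
    intro a d
    have hPND := congrArg (fun y : ℝ => (y : ℂ)) (h.2 e a d e)
    push_cast at hPND
    linear_combination (u a * u d) * hPND
  refine (mul_eq_zero.mp ?_).resolve_left (pow_ne_zero 2 he')
  rw [contr4_eq_sum_contr2]
  simp only [Finset.mul_sum, hpt, Finset.sum_add_distrib, Finset.sum_sub_distrib]
  simp only [← Finset.mul_sum, ← Finset.sum_mul, hu, zero_mul, mul_zero,
    Finset.sum_const_zero, add_zero, sub_zero]

theorem IsPNDGeThree.contr4_eq_zero (hg : gᵀ = g) (h : IsPNDGeThree g C n) {w z : Fin 4 → ℂ}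
    (hw : dotC g (toC n) w = 0) (hz : dotC g (toC n) z ≠ 0) (u v : Fin 4 → ℂ) :
    contr4 C u v (toC n) w = 0 := by
  obtain ⟨e, he⟩ := exists_lower_ne_zero hg hz
  have he' : (lower g n e : ℂ) ≠ 0 := by exact_mod_cast he
  simp only [← sum_dotC_single_mul g (toC n) w, ← ofReal_lower hg] at hw
  have hzero : ∀ a b, ∑ d, (contr1 C n a b d : ℂ) * w d = 0 := by
    intro a b
    refine (mul_eq_zero.mp ?_).resolve_left he'
    have hpt : ∀ d, (lower g n e : ℂ) * ((contr1 C n a b d : ℂ) * w d)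
        = contr1 C n a b e * (lower g n d * w d) := by
      intro d
      have hGeThree := congrArg (fun y : ℝ => (y : ℂ)) (h.2 a b d e)
      push_cast at hGeThree
      linear_combination (w d) * hGeThree
    rw [Finset.mul_sum]
    simp only [hpt, ← Finset.mul_sum, hw, mul_zero]
  simp only [contr4_eq_sum_contr1, hzero, zero_mul, Finset.sum_const_zero]

/-- The bivector `p ∧ q`, with indices lowered by `g`, evaluated on `(u, v)`. -/
def bivector (g : Mat) (p q u v : Fin 4 → ℂ) : ℂ :=
  dotC g p u * dotC g q v - dotC g p v * dotC g q u

/-- The self-dual 4-tensor `U ⊗ V + V ⊗ U + W ⊗ W` evaluated on `(u, v, w, z)`, where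
`U = m' ∧ k`, `V = l ∧ m`, `W = m ∧ m' - l ∧ k`; here `m'` plays the role of `m̄`. -/
def selfDualTypeD (g : Mat) (l k m m' u v w z : Fin 4 → ℂ) : ℂ :=
  bivector g m' k u v * bivector g l m w z + bivector g l m u v * bivector g m' k w z
    + (bivector g m m' u v - bivector g l k u v) * (bivector g m m' w z - bivector g l k w z)

/-- The Weyl-type tensor of a null tetrad whose only nonzero Newman–Penrose scalar is `Ψ₂ = Ψ`. -/
def typeDTensor (g : Mat) (l k : Pt) (m : Fin 4 → ℂ) (Ψ : ℂ) : Tensor4 := fun a b c d =>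
  2 * (Ψ * selfDualTypeD g (toC l) (toC k) m (conjVec m) (Pi.single a 1) (Pi.single b 1)
    (Pi.single c 1) (Pi.single d 1)).re

theorem sum_bivector_single_mul (g : Mat) (p q u v : Fin 4 → ℂ) :
    ∑ a, ∑ b, bivector g p q (Pi.single a 1) (Pi.single b 1) * (u a * v b) =
      bivector g p q u v := by
  simp only [bivector, ← sum_dotC_single_mul g _ u, ← sum_dotC_single_mul g _ v, sub_mul,
    Finset.sum_sub_distrib, Finset.sum_mul_sum]
  rw [Finset.sum_comm (f := fun a b => dotC g p (Pi.single a 1) * v a * _)]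
  congr 1 <;> exact Finset.sum_congr rfl fun a _ => Finset.sum_congr rfl fun b _ => by ring

theorem conj_bivector (g : Mat) (p q u v : Fin 4 → ℂ) :
    conj (bivector g p q u v) =
      bivector g (conjVec p) (conjVec q) (conjVec u) (conjVec v) := by
  simp only [bivector, map_sub, map_mul, conj_dotC]

theorem sum_selfDualTypeD_single_mul (g : Mat) (l k m m' u v w z : Fin 4 → ℂ) :
    ∑ a, ∑ b, ∑ c, ∑ d, selfDualTypeD g l k m m' (Pi.single a 1) (Pi.single b 1) (Pi.single c 1)
      (Pi.single d 1) * u a * v b * w c * z d = selfDualTypeD g l k m m' u v w z := by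
  have hprod : ∀ A B : Fin 4 → Fin 4 → ℂ, ∑ a, ∑ b, ∑ c, ∑ d, A a b * B c d * u a * v b * w c * z d
      = (∑ a, ∑ b, A a b * (u a * v b)) * ∑ c, ∑ d, B c d * (w c * z d) := fun A B => by
    simp only [Finset.sum_mul]
    simp only [Finset.mul_sum]
    exact Finset.sum_congr rfl fun a _ => Finset.sum_congr rfl fun b _ =>
      Finset.sum_congr rfl fun c _ => Finset.sum_congr rfl fun d _ => by ring
  simp only [selfDualTypeD, add_mul, Finset.sum_add_distrib, hprod]
  simp only [sub_mul (bivector _ _ _ _ _), Finset.sum_sub_distrib, sum_bivector_single_mul]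

theorem contr4_typeDTensor (g : Mat) (l k : Pt) (m : Fin 4 → ℂ) (Ψ : ℂ) (u v w z : Fin 4 → ℂ) :
    contr4 (typeDTensor g l k m Ψ) u v w z =
      Ψ * selfDualTypeD g (toC l) (toC k) m (conjVec m) u v w z
        + conj Ψ * selfDualTypeD g (toC l) (toC k) (conjVec m) m u v w z := by
  have hentry : ∀ a b c d, (typeDTensor g l k m Ψ a b c d : ℂ) =
      Ψ * selfDualTypeD g (toC l) (toC k) m (conjVec m) (Pi.single a 1) (Pi.single b 1)
        (Pi.single c 1) (Pi.single d 1)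
      + conj Ψ * selfDualTypeD g (toC l) (toC k) (conjVec m) m (Pi.single a 1) (Pi.single b 1)
        (Pi.single c 1) (Pi.single d 1) := fun a b c d => by
    rw [typeDTensor, Complex.ofReal_mul, Complex.ofReal_ofNat, Complex.re_eq_add_conj]
    simp only [selfDualTypeD, map_mul, map_add, map_sub, conj_bivector, conjVec_toC,
      conjVec_conjVec, conjVec_single]
    ring
  simp only [← sum_selfDualTypeD_single_mul g _ _ _ _ u v w z, contr4, hentry, Finset.mul_sum,
    ← Finset.sum_add_distrib]
  exact Finset.sum_congr rfl fun a _ => Finset.sum_congr rfl fun b _ =>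
    Finset.sum_congr rfl fun c _ => Finset.sum_congr rfl fun d _ => by ring

theorem typeDTensor_zero (g : Mat) (l k : Pt) (m : Fin 4 → ℂ) : typeDTensor g l k m 0 = 0 := by
  funext a b c d
  simp [typeDTensor]

theorem typeDTensor_swap (g : Mat) (l k : Pt) (m : Fin 4 → ℂ) (Ψ : ℂ) :
    typeDTensor g k l (conjVec m) Ψ = typeDTensor g l k m Ψ := by
  funext a b c d
  simp only [typeDTensor, selfDualTypeD, bivector, conjVec_conjVec]
  ring_nf

theorem psi_typeDTensor (hg : gᵀ = g) (h : IsNullTetrad g l k m) (Ψ : ℂ) :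
    Psi0 (typeDTensor g l k m Ψ) l m = 0 ∧ Psi1 (typeDTensor g l k m Ψ) l k m = 0 ∧
      Psi2 (typeDTensor g l k m Ψ) l k m = Ψ ∧ Psi3 (typeDTensor g l k m Ψ) l k m = 0 ∧
      Psi4 (typeDTensor g l k m Ψ) k m = 0 := by
  simp [Psi0, Psi1, Psi2, Psi3, Psi4, contr4_typeDTensor, selfDualTypeD, bivector, h.products hg]

theorem ofReal_ricciTrace_inv (hg : gᵀ = g) (h : IsNullTetrad g l k m) (C : Tensor4)
    (b d : Fin 4) :
    (ricciTrace g⁻¹ C b d : ℂ) =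
      contr4 C (conjVec m) (Pi.single b 1) m (Pi.single d 1)
        + contr4 C m (Pi.single b 1) (conjVec m) (Pi.single d 1)
        - contr4 C (toC k) (Pi.single b 1) (toC l) (Pi.single d 1)
        - contr4 C (toC l) (Pi.single b 1) (toC k) (Pi.single d 1) := by
  have hcontr : ∀ u w : Fin 4 → ℂ, contr4 C u (Pi.single b 1) w (Pi.single d 1) =
      ∑ a, ∑ c, (C c b a d : ℂ) * (w a * u c) := fun u w => by
    rw [Finset.sum_comm]
    simp [contr4, Pi.single_apply, mul_comm, mul_left_comm]
  simp only [ricciTrace, of_apply, Complex.ofReal_sum, Complex.ofReal_mul,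
    h.ofReal_inv_apply hg, hcontr, ← Finset.sum_add_distrib, ← Finset.sum_sub_distrib]
  exact Finset.sum_congr rfl fun a _ => Finset.sum_congr rfl fun c _ => by ring

theorem ricciTrace_typeDTensor (hg : gᵀ = g) (h : IsNullTetrad g l k m) (Ψ : ℂ) :
    ricciTrace g⁻¹ (typeDTensor g l k m Ψ) = 0 := by
  ext b d
  rw [← Complex.ofReal_inj, ofReal_ricciTrace_inv hg h]
  simp only [contr4_typeDTensor, selfDualTypeD, bivector, h.products hg, Matrix.zero_apply,
    Complex.ofReal_zero]
  ring

theorem contr2_typeDTensor (hg : gᵀ = g) (h : IsNullTetrad g l k m) (Ψ : ℂ) (a d : Fin 4) :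
    contr2 (typeDTensor g l k m Ψ) l a d = -(2 * Ψ.re) * (lower g l a * lower g l d) := by
  rw [← Complex.ofReal_inj, ofReal_contr2, contr4_typeDTensor]
  simp only [selfDualTypeD, bivector, h.products hg, ofReal_lower hg, Complex.ofReal_mul,
    Complex.ofReal_neg, Complex.ofReal_ofNat, Complex.re_eq_add_conj]
  ring

theorem IsNullTetrad.isNullVec (h : IsNullTetrad g l k m) : IsNullVec g l := by
  refine (isNullVec_iff fun hl => ?_).2 h.1
  have hlk := h.2.2.2.2.1
  simp [hl, toC, dotC] at hlk

theorem isDoublePND_typeDTensor (hg : gᵀ = g) (h : IsNullTetrad g l k m) (hΨ : Ψ ≠ 0) :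
    IsDoublePND g (typeDTensor g l k m Ψ) l := by
  refine ⟨⟨h.isNullVec, fun a d e => ?_⟩, fun hthree => hΨ ?_⟩
  · simp only [contr2_typeDTensor hg h]
    ring
  · have hzero := hthree.contr4_eq_zero hg (w := m) (z := toC k) (by simp only [h.products hg])
      (by simp only [h.products hg]; norm_num) (conjVec m) (toC k)
    simpa [contr4_typeDTensor, selfDualTypeD, bivector, h.products hg] using hzero

theorem IsNullTetrad.linearIndependent (hg : gᵀ = g) (h : IsNullTetrad g l k m) :
    LinearIndependent ℝ ![l, k] := by
  refine LinearIndependent.pair_iff.2 fun s t hst => ?_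
  have hdot : ∀ u,
      dotC g u (toC (s • l + t • k)) = s * dotC g u (toC l) + t * dotC g u (toC k) := by
    intro u
    have hlin : toC (s • l + t • k) = (s : ℂ) • toC l + (t : ℂ) • toC k := by
      funext i
      simp [toC]
    simp only [hlin, dotC_eq_dotProduct, mulVec_add, mulVec_smul, dotProduct_add, dotProduct_smul,
      smul_eq_mul]
  have hzero : ∀ u, dotC g u (toC (s • l + t • k)) = 0 := fun u => by
    rw [hst]
    simp [toC, dotC]
  have hk := (hdot (toC k)).symm.trans (hzero _)
  have hl := (hdot (toC l)).symm.trans (hzero _)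
  simp only [h.products hg] at hk hl
  constructor
  · simpa using hk
  · simpa using hl

theorem eq_re_smul_of_toC_eq {c : ℂ} (h : toC n = c • toC l) : n = c.re • l := by
  funext a
  simpa [toC] using congrArg Complex.re (congrFun h a)

theorem IsNullTetrad.dotC_mul_dotC_of_isNullVec (hg : gᵀ = g) (h : IsNullTetrad g l k m)
    (hn : IsNullVec g n) :
    dotC g (toC l) (toC n) * dotC g (toC k) (toC n) =
      dotC g m (toC n) * conj (dotC g m (toC n)) := by
  have hnull : dotC g (toC n) (toC n) = 0 := (isNullVec_iff hn.1).1 hn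
  have hexpand := congrArg (dotC g (toC n)) (h.eq_sum hg (toC n))
  simp only [dotC_eq_dotProduct g (toC n), mulVec_add, mulVec_sub, mulVec_smul, dotProduct_add,
    dotProduct_sub, dotProduct_smul, smul_eq_mul] at hexpand
  simp only [← dotC_eq_dotProduct, hnull, dotC_comm hg (toC n)] at hexpand
  rw [conj_dotC, conjVec_toC]
  linear_combination hexpand / 2

theorem IsPND.dotC_mul_dotC_eq_zero (hg : gᵀ = g) (h : IsNullTetrad g l k m) (hΨ : Ψ ≠ 0)
    (hn : IsPND g (typeDTensor g l k m Ψ) n) : dotC g (toC l) (toC n) * dotC g m (toC n) = 0 := by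
  set p := dotC g (toC l) (toC n) with hp
  set w := dotC g m (toC n) with hw
  by_contra hpw
  have horth : dotC g (toC n) (p • m - w • toC l) = 0 := by
    rw [dotC_sub_right, dotC_smul_right, dotC_smul_right, dotC_comm hg, ← hw, dotC_comm hg, ← hp]
    ring
  have hzero := hn.contr4_eq_zero hg horth (w := toC l)
    (by rw [dotC_comm hg, ← hp]; exact left_ne_zero_of_mul hpw)
  have hvalue : conj Ψ * (6 * (p * w) ^ 2) = 0 := by
    rw [contr4_typeDTensor] at hzero
    simp only [selfDualTypeD, bivector, dotC_sub_right, dotC_smul_right, h.products hg, ← hp, ← hw]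
      at hzero
    linear_combination -hzero
  simp [hΨ, left_ne_zero_of_mul hpw, right_ne_zero_of_mul hpw] at hvalue

theorem IsPND.eq_smul_of_typeDTensor (hg : gᵀ = g) (h : IsNullTetrad g l k m) (hΨ : Ψ ≠ 0)
    (hn : IsPND g (typeDTensor g l k m Ψ) n) : ∃ c : ℝ, n = c • l ∨ n = c • k := by
  have hexpand := h.eq_sum hg (toC n)
  have hconj : dotC g (conjVec m) (toC n) = conj (dotC g m (toC n)) := by
    rw [conj_dotC, conjVec_toC]
  have hnull := h.dotC_mul_dotC_of_isNullVec hg hn.1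
  have hw : dotC g m (toC n) = 0 := by
    rcases mul_eq_zero.1 (hn.dotC_mul_dotC_eq_zero hg h hΨ) with hp | hw
    · simpa only [hp, zero_mul, zero_eq_mul, map_eq_zero, or_self] using hnull
    · exact hw
  rw [hconj, hw] at hexpand
  rw [hw, zero_mul] at hnull
  rcases mul_eq_zero.1 hnull with hp | hq
  · exact ⟨_, .inl (eq_re_smul_of_toC_eq (c := -dotC g (toC k) (toC n))
      (by simpa [hp] using hexpand))⟩
  · exact ⟨_, .inr (eq_re_smul_of_toC_eq (c := -dotC g (toC l) (toC n))
      (by simpa [hq] using hexpand))⟩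

theorem hasDoublePNDPair_typeDTensor (hg : gᵀ = g) (h : IsNullTetrad g l k m) (hΨ : Ψ ≠ 0) :
    HasDoublePNDPair g (typeDTensor g l k m Ψ) l k :=
  ⟨h.linearIndependent hg, isDoublePND_typeDTensor hg h hΨ,
    typeDTensor_swap g l k m Ψ ▸ isDoublePND_typeDTensor hg (h.swap hg) hΨ,
    fun _ hn => hn.eq_smul_of_typeDTensor hg h hΨ⟩

theorem not_isPetrovTypeD_zero (g : Mat) : ¬ IsPetrovTypeD g 0 := by
  rintro ⟨n, _, _, hn, _⟩
  exact hn.2 ⟨hn.1.1, fun a b d e => by simp [contr1]⟩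

theorem isPetrovTypeD_typeDTensor_iff (hg : gᵀ = g) (h : IsNullTetrad g l k m) :
    IsPetrovTypeD g (typeDTensor g l k m Ψ) ↔ Ψ ≠ 0 := by
  refine ⟨?_, fun hΨ => ⟨l, k, hasDoublePNDPair_typeDTensor hg h hΨ⟩⟩
  rintro hD rfl
  exact not_isPetrovTypeD_zero g (typeDTensor_zero g l k m ▸ hD)

end TypeD

section SkewMatrix

/-- The skew matrix with entries `w` above the diagonal, in the order `01, 02, 03, 12, 13, 23`. -/
def skewMatrix (w : Fin 6 → ℝ) : Mat :=
  !![0, w 0, w 1, w 2; -w 0, 0, w 3, w 4; -w 1, -w 3, 0, w 5; -w 2, -w 4, -w 5, 0]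

theorem skewMatrix_transpose (w : Fin 6 → ℝ) : (skewMatrix w)ᵀ = -skewMatrix w := by
  ext i j
  fin_cases i <;> fin_cases j <;> simp [skewMatrix]

theorem eq_skewMatrix {A : Mat} (hA : Aᵀ = -A) :
    A = skewMatrix ![A 0 1, A 0 2, A 0 3, A 1 2, A 1 3, A 2 3] := by
  have hA' : ∀ i j, A j i = -A i j := fun i j => congrFun (congrFun hA i) j
  have hdiag : ∀ i, A i i = 0 := fun i => by linarith [hA' i i]
  ext i j
  fin_cases i <;> fin_cases j <;> simp [skewMatrix, hdiag, ← hA']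

theorem hasPd_skewMatrix {c : Fin 4} {w : Pt → Fin 6 → ℝ} {w' : Fin 6 → ℝ} {x : Pt}
    (hw : ∀ i, HasPd c (fun y => w y i) (w' i) x) :
    HasPd c (fun y => skewMatrix (w y)) (skewMatrix w') x := by
  refine hasPd_matrix.2 fun j k => ?_
  fin_cases j <;> fin_cases k <;> first | exact hasPd_const 0 | exact hw _ | exact (hw _).neg

theorem hasPd_diagonal {c : Fin 4} {v : Pt → Fin 4 → ℝ} {v' : Fin 4 → ℝ} {x : Pt}
    (hv : ∀ i, HasPd c (fun y => v y i) (v' i) x) :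
    HasPd c (fun y => diagonal (v y)) (diagonal v') x := by
  refine hasPd_matrix.2 fun j k => ?_
  by_cases hjk : j = k
  · subst hjk
    simpa only [diagonal_apply_eq] using hv j
  · simp only [diagonal_apply_ne _ hjk]
    exact hasPd_const 0

end SkewMatrix

section KerrConnection

/-- The coframe of the forms `formT`, `formR`, `formTheta`, `formPhi`. -/
def coframe (a : ℝ) (x : Pt) : Mat := of ![formT a x, formR, formTheta, formPhi a x]

/-- The squared lengths of the dual frame of `coframe`. -/
def frameNorm (a : ℝ) (M : ℝ → ℝ) (x : Pt) : Fin 4 → ℝ :=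
  ![-(Del a M x / Sig a x), Sig a x / Del a M x, Sig a x, Real.sin (x 2) ^ 2 / Sig a x]

/-- The component `ω₀₁(∂_t)` of the connection, which is the `r`-derivative of `r M / Σ`. -/
def boost (a : ℝ) (M : ℝ → ℝ) (x : Pt) : ℝ :=
  (M (x 1) + x 1 * deriv M (x 1)) / Sig a x - 2 * (x 1 ^ 2 * M (x 1)) / Sig a x ^ 2

/-- The component `ω₂₃(∂_t)` of the connection: `-a` times it is the `θ`-derivative of `r M / Σ`. -/
def twist (a : ℝ) (M : ℝ → ℝ) (x : Pt) : ℝ :=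
  -(2 * a * (Real.sin (x 2) * Real.cos (x 2) * (x 1 * M (x 1))) / Sig a x ^ 2)

/-- The partial derivative of the `j`-th coordinate in the `c`-th coordinate direction. -/
def kronecker (c j : Fin 4) : ℝ := (Pi.single c 1 : Pt) j

/-- The partial derivatives of `Sig`. -/
def sigDeriv (a : ℝ) (c : Fin 4) (x : Pt) : ℝ :=
  2 * x 1 * kronecker c 1 - 2 * a ^ 2 * (Real.sin (x 2) * Real.cos (x 2)) * kronecker c 2

/-- The partial derivatives of `Del`. -/
def delDeriv (M : ℝ → ℝ) (c : Fin 4) (x : Pt) : ℝ :=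
  (2 * x 1 - 2 * (M (x 1) + x 1 * deriv M (x 1))) * kronecker c 1

/-- The partial derivatives of `boost`. -/
def boostDeriv (a : ℝ) (M : ℝ → ℝ) (c : Fin 4) (x : Pt) : ℝ :=
  ((2 * deriv M (x 1) + x 1 * deriv (deriv M) (x 1)) / Sig a x
      - 2 * (2 * x 1 * M (x 1) + x 1 ^ 2 * deriv M (x 1)) / Sig a x ^ 2) * kronecker c 1
    - ((M (x 1) + x 1 * deriv M (x 1)) / Sig a x ^ 2
      - 4 * (x 1 ^ 2 * M (x 1)) / Sig a x ^ 3) * sigDeriv a c x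

/-- The partial derivatives of `twist`. -/
def twistDeriv (a : ℝ) (M : ℝ → ℝ) (c : Fin 4) (x : Pt) : ℝ :=
  -(2 * a * (Real.sin (x 2) * Real.cos (x 2) * (M (x 1) + x 1 * deriv M (x 1)) / Sig a x ^ 2
      * kronecker c 1
    + (Real.cos (x 2) ^ 2 - Real.sin (x 2) ^ 2) * (x 1 * M (x 1)) / Sig a x ^ 2 * kronecker c 2
    - 2 * (Real.sin (x 2) * Real.cos (x 2) * (x 1 * M (x 1))) / Sig a x ^ 3 * sigDeriv a c x))

variable {a : ℝ} {M : ℝ → ℝ} {x : Pt} {c : Fin 4}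

theorem hasPd_coord (j : Fin 4) : HasPd c (fun y => y j) (kronecker c j) x :=
  hasDerivAt_pi.1 (hasDerivAt_update x c (x c)) j

theorem hasPd_radial {f : ℝ → ℝ} {f' : ℝ} (hf : HasDerivAt f f' (x 1)) :
    HasPd c (fun y => f (y 1)) (f' * kronecker c 1) x :=
  HasPd.comp_of_hasDerivAt hf (hasPd_coord 1)

theorem hasPd_sin : HasPd c (fun y => Real.sin (y 2)) (Real.cos (x 2) * kronecker c 2) x :=
  HasPd.comp_of_hasDerivAt (Real.hasDerivAt_sin (x 2)) (hasPd_coord 2)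

theorem hasPd_cos : HasPd c (fun y => Real.cos (y 2)) (-Real.sin (x 2) * kronecker c 2) x :=
  HasPd.comp_of_hasDerivAt (Real.hasDerivAt_cos (x 2)) (hasPd_coord 2)

theorem hasPd_sin_sq : HasPd c (fun y => Real.sin (y 2) ^ 2)
    (2 * (Real.sin (x 2) * Real.cos (x 2)) * kronecker c 2) x :=
  hasPd_sin.sq.congr_deriv (by ring)

theorem hasPd_sin_mul_cos : HasPd c (fun y => Real.sin (y 2) * Real.cos (y 2))
    ((Real.cos (x 2) ^ 2 - Real.sin (x 2) ^ 2) * kronecker c 2) x :=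
  (hasPd_sin.mul hasPd_cos).congr_deriv (by ring)

theorem hasPd_Sig : HasPd c (Sig a) (sigDeriv a c x) x :=
  ((hasPd_coord 1).sq.add (hasPd_cos.sq.const_mul (a ^ 2))).congr_deriv (by rw [sigDeriv]; ring)

theorem hasPd_Del (hM : DifferentiableAt ℝ M (x 1)) : HasPd c (Del a M) (delDeriv M c x) x :=
  (((hasPd_coord 1).sq.sub (((hasPd_radial hM.hasDerivAt).const_mul 2).mul (hasPd_coord 1))).add
    (hasPd_const (a ^ 2))).congr_deriv (by rw [delDeriv]; ring)

theorem hasPd_mul_mass (hM : DifferentiableAt ℝ M (x 1)) :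
    HasPd c (fun y => y 1 * M (y 1)) ((M (x 1) + x 1 * deriv M (x 1)) * kronecker c 1) x :=
  ((hasPd_coord 1).mul (hasPd_radial hM.hasDerivAt)).congr_deriv (by ring)

theorem hasPd_boost (hS : Sig a x ≠ 0) (hM : DifferentiableAt ℝ M (x 1))
    (hM' : DifferentiableAt ℝ (deriv M) (x 1)) : HasPd c (boost a M) (boostDeriv a M c x) x := by
  have hnum := (hasPd_radial (c := c) hM.hasDerivAt).add
    ((hasPd_coord 1).mul (hasPd_radial hM'.hasDerivAt))
  have hnum₂ := ((hasPd_coord (c := c) 1).sq.mul (hasPd_radial hM.hasDerivAt)).const_mul 2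
  refine ((hnum.div hasPd_Sig hS).sub
    (hnum₂.div hasPd_Sig.sq (pow_ne_zero 2 hS))).congr_deriv ?_
  rw [boostDeriv]
  field_simp
  ring

theorem hasPd_twist (hS : Sig a x ≠ 0) (hM : DifferentiableAt ℝ M (x 1)) :
    HasPd c (twist a M) (twistDeriv a M c x) x := by
  have hnum := (hasPd_sin_mul_cos (c := c).mul (hasPd_mul_mass hM)).const_mul (2 * a)
  refine (hnum.div hasPd_Sig.sq (pow_ne_zero 2 hS)).neg.congr_deriv ?_
  rw [twistDeriv]
  field_simp
  ring

/-- The partial derivatives of `coframe`. -/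
def coframeDeriv (a : ℝ) (c : Fin 4) (x : Pt) : Mat :=
  single 0 3 (-(2 * a * (Real.sin (x 2) * Real.cos (x 2)) * kronecker c 2))
    + single 3 3 (-(2 * x 1 * kronecker c 1))

/-- The partial derivatives of `frameNorm`. -/
def frameNormDeriv (a : ℝ) (M : ℝ → ℝ) (c : Fin 4) (x : Pt) : Fin 4 → ℝ :=
  ![-((delDeriv M c x * Sig a x - Del a M x * sigDeriv a c x) / Sig a x ^ 2),
    (sigDeriv a c x * Del a M x - Sig a x * delDeriv M c x) / Del a M x ^ 2,
    sigDeriv a c x,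
    (2 * (Real.sin (x 2) * Real.cos (x 2)) * kronecker c 2 * Sig a x
      - Real.sin (x 2) ^ 2 * sigDeriv a c x) / Sig a x ^ 2]

/-- The skew part `ω_{ij}(∂_c)` of the connection, the pairs `i < j` being ordered as in
`skewMatrix`. -/
def spin (a : ℝ) (M : ℝ → ℝ) (c : Fin 4) (x : Pt) : Fin 6 → ℝ :=
  let r := x 1
  let s2 := Real.sin (x 2) ^ 2
  let sc := Real.sin (x 2) * Real.cos (x 2)
  match c with
  | 0 => ![boost a M x, 0, 0, 0, 0, twist a M x]
  | 1 => ![0, 0, -(a * (r * s2 / Sig a x ^ 2)), -(a ^ 2 * (sc / Del a M x)), 0, 0]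
  | 2 => ![0, 0, a * (sc * Del a M x / Sig a x ^ 2), -r, 0, 0]
  | 3 => ![a * (s2 * (r / Sig a x - boost a M x)), a * (sc * Del a M x / Sig a x), 0, 0,
      r * s2 / Sig a x, sc * (r ^ 2 + a ^ 2) / Sig a x - a * (s2 * twist a M x)]

/-- The partial derivative of `spin a M d` in the `c`-th coordinate direction. -/
def spinDeriv (a : ℝ) (M : ℝ → ℝ) (c d : Fin 4) (x : Pt) : Fin 6 → ℝ :=
  let r := x 1
  let r' := kronecker c 1
  let s2 := Real.sin (x 2) ^ 2
  let sc := Real.sin (x 2) * Real.cos (x 2)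
  let s2' := 2 * sc * kronecker c 2
  let sc' := (Real.cos (x 2) ^ 2 - Real.sin (x 2) ^ 2) * kronecker c 2
  let S := Sig a x
  let S' := sigDeriv a c x
  let D := Del a M x
  let D' := delDeriv M c x
  match d with
  | 0 => ![boostDeriv a M c x, 0, 0, 0, 0, twistDeriv a M c x]
  | 1 => ![0, 0, -(a * (((r' * s2 + r * s2') * S ^ 2 - r * s2 * (2 * S * S')) / (S ^ 2) ^ 2)),
      -(a ^ 2 * ((sc' * D - sc * D') / D ^ 2)), 0, 0]
  | 2 => ![0, 0, a * (((sc' * D + sc * D') * S ^ 2 - sc * D * (2 * S * S')) / (S ^ 2) ^ 2),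
      -r', 0, 0]
  | 3 => ![a * (s2' * (r / S - boost a M x)
          + s2 * ((r' * S - r * S') / S ^ 2 - boostDeriv a M c x)),
      a * (((sc' * D + sc * D') * S - sc * D * S') / S ^ 2), 0, 0,
      ((r' * s2 + r * s2') * S - r * s2 * S') / S ^ 2,
      ((sc' * (r ^ 2 + a ^ 2) + sc * (2 * r * r')) * S - sc * (r ^ 2 + a ^ 2) * S') / S ^ 2
        - a * (s2' * twist a M x + s2 * twistDeriv a M c x)]

/-- The Levi-Civita connection of the Kerr-like metric in the coframe `coframe`, with frame indices
lowered by `frameNorm`. -/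
def connection (a : ℝ) (M : ℝ → ℝ) (c : Fin 4) (x : Pt) : Mat :=
  diagonal ((1 / 2 : ℝ) • frameNormDeriv a M c x) + skewMatrix (spin a M c x)

theorem hasPd_coframe : HasPd c (coframe a) (coframeDeriv a c x) x := by
  have h03 := (hasPd_sin_sq (c := c) (x := x).const_mul a).neg
  have h33 := ((hasPd_coord (c := c) (x := x) 1).sq.add (hasPd_const (a ^ 2))).neg
  refine hasPd_matrix.2 fun j k => ?_
  fin_cases j <;> fin_cases k <;>
    first
    | exact h03.congr_deriv (by simp [coframeDeriv]; ring)
    | exact h33.congr_deriv (by simp [coframeDeriv])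
    | exact (hasPd_const _).congr_deriv (by simp [coframeDeriv])

theorem hasPd_frameNorm (hS : Sig a x ≠ 0) (hD : Del a M x ≠ 0)
    (hM : DifferentiableAt ℝ M (x 1)) (i : Fin 4) :
    HasPd c (fun y => frameNorm a M y i) (frameNormDeriv a M c x i) x := by
  fin_cases i
  · exact ((hasPd_Del hM).div hasPd_Sig hS).neg
  · exact hasPd_Sig.div (hasPd_Del hM) hD
  · exact hasPd_Sig
  · exact hasPd_sin_sq.div hasPd_Sig hS

theorem hasPd_spin (hS : Sig a x ≠ 0) (hD : Del a M x ≠ 0) (hM : DifferentiableAt ℝ M (x 1))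
    (hM' : DifferentiableAt ℝ (deriv M) (x 1)) (d : Fin 4) (i : Fin 6) :
    HasPd c (fun y => spin a M d y i) (spinDeriv a M c d x i) x := by
  have hS2 := pow_ne_zero 2 hS
  have hr := hasPd_coord (c := c) (x := x) 1
  have hscD := hasPd_sin_mul_cos.mul (hasPd_Del (a := a) (c := c) hM)
  have hrs := hr.mul hasPd_sin_sq
  have hra := (hr.sq.add (hasPd_const (a ^ 2))).congr_deriv (add_zero _)
  have hboost := hasPd_boost (c := c) hS hM hM'
  have htwist := hasPd_twist (c := c) hS hM
  fin_cases d <;> fin_cases i <;>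
    first
    | exact hboost
    | exact htwist
    | exact hr.neg
    | exact hrs.div hasPd_Sig hS
    | exact ((hrs.div hasPd_Sig.sq hS2).const_mul a).neg
    | exact ((hasPd_sin_mul_cos.div (hasPd_Del hM) hD).const_mul (a ^ 2)).neg
    | exact (hscD.div hasPd_Sig.sq hS2).const_mul a
    | exact (hasPd_sin_sq.mul ((hr.div hasPd_Sig hS).sub hboost)).const_mul a
    | exact (hscD.div hasPd_Sig hS).const_mul a
    | exact ((hasPd_sin_mul_cos.mul hra).div hasPd_Sig hS).sub
        ((hasPd_sin_sq.mul htwist).const_mul a)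
    | exact hasPd_const 0

theorem connection_torsionFree (hS : Sig a x ≠ 0) (hD : Del a M x ≠ 0) (i b c : Fin 4) :
    (diagonal (frameNorm a M x) * coframeDeriv a c x + connection a M c x * coframe a x) i b =
      (diagonal (frameNorm a M x) * coframeDeriv a b x + connection a M b x * coframe a x) i c := by
  wlog hbc : b < c generalizing b c
  · rcases (not_lt.1 hbc).eq_or_lt with rfl | h
    · rfl
    · exact (this c b h).symm
  have hS' : Sig a x = x 1 ^ 2 + a ^ 2 * (1 - Real.sin (x 2) ^ 2) := by
    rw [Sig, Real.cos_sq']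
  have hD' : Del a M x = x 1 ^ 2 - 2 * M (x 1) * x 1 + a ^ 2 := rfl
  simp only [Matrix.add_apply, Matrix.mul_apply, Fin.sum_univ_four]
  fin_cases b <;> fin_cases c <;> first | exact absurd hbc (by decide) | skip
  all_goals
    fin_cases i <;>
      simp [coframeDeriv, connection, skewMatrix, coframe, formT, formR, formTheta, formPhi,
        frameNorm, frameNormDeriv, kronecker, spin, boost, twist, sigDeriv, delDeriv,
        Matrix.single] <;>
      field_simp <;> simp only [hS', hD'] <;> ring

end KerrConnection

section KerrCurvature

/-- The real part of `Ψ₂`. -/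
def psi2Re (a : ℝ) (M : ℝ → ℝ) (x : Pt) : ℝ :=
  -(12 * (x 1 ^ 2 - a ^ 2 * Real.cos (x 2) ^ 2) * (x 1 * M (x 1))
    - 6 * Sig a x * x 1 * (M (x 1) + x 1 * deriv M (x 1))
    + Sig a x ^ 2 * (2 * deriv M (x 1) + x 1 * deriv (deriv M) (x 1))) / (6 * Sig a x ^ 3)

/-- The imaginary part of `Ψ₂`. -/
def psi2Im (a : ℝ) (M : ℝ → ℝ) (x : Pt) : ℝ :=
  a * Real.cos (x 2) * (Sig a x * (M (x 1) + x 1 * deriv M (x 1)) - 4 * x 1 * (x 1 * M (x 1)))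
    / Sig a x ^ 3

/-- The eigenvalue of `P` on the plane where `formTheta` and `formPhi` vanish, for the tensor `P`
with `Riemann = Weyl + (1/2) g ∧ P` (Kulkarni–Nomizu product). -/
def schoutenRadial (a : ℝ) (M : ℝ → ℝ) (x : Pt) : ℝ :=
  (4 * deriv M (x 1) + 2 * x 1 * deriv (deriv M) (x 1)) / (3 * Sig a x)
    - 2 * x 1 ^ 2 * deriv M (x 1) / Sig a x ^ 2

/-- The eigenvalue on the plane where `formT` and `formR` vanish of the tensor `P` of
`schoutenRadial`. -/
def schoutenAngular (a : ℝ) (M : ℝ → ℝ) (x : Pt) : ℝ :=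
  2 * x 1 ^ 2 * deriv M (x 1) / Sig a x ^ 2
    - (2 * deriv M (x 1) + x 1 * deriv (deriv M) (x 1)) / (3 * Sig a x)

/-- The components `(Θⁱ ∧ Θʲ)(∂_c, ∂_d)`, where the 1-forms `Θⁱ` are the rows of `Θ`. -/
def area (Θ : Mat) (i j c d : Fin 4) : ℝ := Θ i c * Θ j d - Θ i d * Θ j c

/-- The curvature 2-forms `Ω_{ij}(∂_c, ∂_d)` in the coframe `coframe`, frame indices lowered, the
pairs `i < j` being ordered as in `skewMatrix`. -/
def curvatureForm (a : ℝ) (M : ℝ → ℝ) (x : Pt) (c d : Fin 4) : Fin 6 → ℝ :=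
  let S := Sig a x
  let D := Del a M x
  let s := Real.sin (x 2)
  let p := psi2Re a M x
  let qs := psi2Im a M x * s
  let l := schoutenRadial a M x
  let l' := schoutenAngular a M x
  let B := fun i j => area (coframe a x) i j c d
  ![(2 * p - l) * B 0 1 + 2 * qs * B 2 3,
    (p + (l + l') / 2) * -D * B 0 2 + qs * B 1 3,
    (p + (l + l') / 2) * -(D * s ^ 2 / S ^ 2) * B 0 3 - qs * B 1 2,
    (p + (l + l') / 2) * (S ^ 2 / D) * B 1 2 - qs * B 0 3,
    (p + (l + l') / 2) * (s ^ 2 / D) * B 1 3 + qs * B 0 2,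
    (-2 * p + l') * s ^ 2 * B 2 3 + 2 * qs * B 0 1]

variable {a : ℝ} {M : ℝ → ℝ} {x : Pt} {c d : Fin 4}

/-- The curvature 2-forms `dω + ω ∧ ω` of `connection`, frame indices lowered, evaluated on
`(∂_c, ∂_d)`. Only the skew part of `connection` is differentiated: the diagonal part consists of
partial derivatives, whose contributions cancel by symmetry of second derivatives. -/
def connectionCurvature (a : ℝ) (M : ℝ → ℝ) (x : Pt) (c d : Fin 4) : Mat :=
  skewMatrix (spinDeriv a M c d x) - skewMatrix (spinDeriv a M d c x)
    - (connection a M c x)ᵀ * (diagonal (frameNorm a M x))⁻¹ * connection a M d x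
    + (connection a M d x)ᵀ * (diagonal (frameNorm a M x))⁻¹ * connection a M c x

theorem frameNorm_inv (hS : Sig a x ≠ 0) (hD : Del a M x ≠ 0) (hs : Real.sin (x 2) ≠ 0) :
    (diagonal (frameNorm a M x))⁻¹ = diagonal ![-(Sig a x / Del a M x), Del a M x / Sig a x,
      1 / Sig a x, Sig a x / Real.sin (x 2) ^ 2] := by
  refine inv_eq_right_inv ?_
  rw [diagonal_mul_diagonal, ← diagonal_one]
  congr 1
  funext i
  fin_cases i <;> simp [frameNorm] <;> field_simp

theorem matrix_eq_zero_of_eq_neg {A : Mat} (hA : A = -A) : A = 0 := by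
  ext i j
  have hij : A i j = -A i j := congrFun (congrFun hA i) j
  exact self_eq_neg.1 hij

theorem connectionCurvature_transpose :
    (connectionCurvature a M x c d)ᵀ = -connectionCurvature a M x c d := by
  simp only [connectionCurvature, transpose_add, transpose_sub, transpose_mul, transpose_transpose,
    skewMatrix_transpose, transpose_nonsing_inv, diagonal_transpose, Matrix.mul_assoc]
  abel

theorem connectionCurvature_swap :
    connectionCurvature a M x d c = -connectionCurvature a M x c d := by
  simp only [connectionCurvature]
  abel

theorem skewMatrix_curvatureForm_swap :
    skewMatrix (curvatureForm a M x d c) = -skewMatrix (curvatureForm a M x c d) := by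
  have hB : ∀ i j, area (coframe a x) i j d c = -area (coframe a x) i j c d := fun i j => by
    simp only [area, neg_sub]
  ext i j
  fin_cases i <;> fin_cases j <;> simp [skewMatrix, curvatureForm, hB] <;> ring

set_option maxHeartbeats 4000000 in
theorem connectionCurvature_eq (hS : Sig a x ≠ 0) (hD : Del a M x ≠ 0) (hs : Real.sin (x 2) ≠ 0) :
    connectionCurvature a M x c d = skewMatrix (curvatureForm a M x c d) := by
  wlog hcd : c < d generalizing c d
  · rcases (not_lt.1 hcd).eq_or_lt with rfl | h
    · rw [matrix_eq_zero_of_eq_neg connectionCurvature_swap,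
        matrix_eq_zero_of_eq_neg skewMatrix_curvatureForm_swap]
    · rw [connectionCurvature_swap, skewMatrix_curvatureForm_swap, this h]
  have hcos : Real.cos (x 2) ^ 2 = 1 - Real.sin (x 2) ^ 2 := Real.cos_sq' _
  have hcos₃ : Real.cos (x 2) ^ 3 = Real.cos (x 2) * (1 - Real.sin (x 2) ^ 2) := by
    rw [← hcos]; ring
  have hcos₄ : Real.cos (x 2) ^ 4 = (1 - Real.sin (x 2) ^ 2) ^ 2 := by rw [← hcos]; ring
  have hS' : Sig a x = x 1 ^ 2 + a ^ 2 * (1 - Real.sin (x 2) ^ 2) := by rw [Sig, hcos]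
  have hD' : Del a M x = x 1 ^ 2 - 2 * M (x 1) * x 1 + a ^ 2 := rfl
  rw [eq_skewMatrix connectionCurvature_transpose]
  congr 1
  funext i
  simp only [connectionCurvature, frameNorm_inv hS hD hs, Matrix.add_apply, Matrix.sub_apply,
    mul_apply, Fin.sum_univ_four, curvatureForm, area, connection, coframe]
  fin_cases c <;> fin_cases d <;> first | exact absurd hcd (by decide) | skip
  all_goals
    fin_cases i <;>
      simp [spinDeriv, spin, skewMatrix, frameNormDeriv, sigDeriv, delDeriv, boost, twist,
        boostDeriv, twistDeriv, kronecker, formT, formR, formTheta, formPhi, psi2Re, psi2Im,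
        schoutenRadial, schoutenAngular] <;>
      field_simp <;> simp only [hS', hD'] <;> ring_nf <;> simp only [hcos, hcos₃, hcos₄] <;> ring

end KerrCurvature

section KerrRiemann

variable {a : ℝ} {M : ℝ → ℝ} {I : Set ℝ} {x : Pt}

theorem transpose_mul_diagonal_mul_apply (Θ : Mat) (h : Fin 4 → ℝ) (i j : Fin 4) :
    (Θᵀ * diagonal h * Θ) i j = ∑ k, h k * (Θ k i * Θ k j) := by
  rw [mul_apply]
  refine Finset.sum_congr rfl fun k _ => ?_
  rw [mul_diagonal, transpose_apply]
  ring

theorem metric_eq_coframe (a : ℝ) (M : ℝ → ℝ) (x : Pt) :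
    metric a M x = (coframe a x)ᵀ * diagonal (frameNorm a M x) * coframe a x := by
  ext i j
  simp only [transpose_mul_diagonal_mul_apply, metric, coframe, frameNorm, of_apply,
    Fin.sum_univ_four, cons_val]

theorem metric_symm (a : ℝ) (M : ℝ → ℝ) (x : Pt) : (metric a M x)ᵀ = metric a M x := by
  simp only [metric_eq_coframe, transpose_mul, transpose_transpose, diagonal_transpose,
    Matrix.mul_assoc]

theorem det_coframe (a : ℝ) (x : Pt) : (coframe a x).det = -Sig a x := by
  simp [coframe, formT, formR, formTheta, formPhi, det_succ_row_zero, Fin.sum_univ_succ,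
    Fin.succAbove, Sig, Real.cos_sq']
  ring

theorem sin_ne_zero (hx : x ∈ domain a M I) : Real.sin (x 2) ≠ 0 :=
  (Real.sin_pos_of_mem_Ioo hx.2.1).ne'

theorem det_frameNorm_ne_zero (hx : x ∈ domain a M I) :
    (diagonal (frameNorm a M x)).det ≠ 0 := by
  have hsin := sin_ne_zero hx
  obtain ⟨-, -, hS, hD⟩ := hx
  simp [det_diagonal, Fin.prod_univ_four, frameNorm, hS, hD, hsin]

theorem det_metric_ne_zero (hx : x ∈ domain a M I) : (metric a M x).det ≠ 0 := by
  have hcoframe : (coframe a x).det ≠ 0 := det_coframe a x ▸ neg_ne_zero.2 hx.2.2.1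
  rw [metric_eq_coframe, det_mul, det_mul, det_transpose]
  exact mul_ne_zero (mul_ne_zero hcoframe (det_frameNorm_ne_zero hx)) hcoframe

theorem continuous_Sig (a : ℝ) : Continuous (Sig a) := by
  unfold Sig
  fun_prop

theorem isOpen_domain (hI : IsOpen I) (hM : ContinuousOn M I) : IsOpen (domain a M I) := by
  have hopen_r : IsOpen {x : Pt | x 1 ∈ I} := hI.preimage (continuous_apply 1)
  have hM_comp : ContinuousOn (fun x : Pt => M (x 1)) {x : Pt | x 1 ∈ I} :=
    hM.comp (continuous_apply 1).continuousOn fun _ hx => hx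
  have hr : ContinuousOn (fun x : Pt => x 1) {x : Pt | x 1 ∈ I} := by fun_prop
  have hDel : ContinuousOn (Del a M) {x : Pt | x 1 ∈ I} :=
    ((hr.pow 2).sub ((continuousOn_const.mul hM_comp).mul hr)).add continuousOn_const
  have hopen_Sig : IsOpen {x : Pt | Sig a x ≠ 0} :=
    isOpen_ne_fun (continuous_Sig a) continuous_const
  have hopen_θ : IsOpen {x : Pt | x 2 ∈ Set.Ioo 0 Real.pi} :=
    isOpen_Ioo.preimage (continuous_apply 2)
  have hopen_Del : IsOpen ({x : Pt | x 1 ∈ I} ∩ Del a M ⁻¹' {0}ᶜ) :=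
    hDel.isOpen_inter_preimage hopen_r isOpen_compl_singleton
  convert hopen_Del.inter (hopen_θ.inter hopen_Sig) using 1
  ext x
  simp only [domain, Set.mem_ofPred_eq, Set.mem_inter_iff, Set.mem_preimage, Set.mem_compl_iff,
    Set.mem_singleton_iff]
  tauto

theorem contDiff_coframe (a : ℝ) (i j : Fin 4) : ContDiff ℝ 2 fun y => coframe a y i j := by
  have h03 : ContDiff ℝ 2 fun y : Pt => -(a * Real.sin (y 2) ^ 2) := by fun_prop
  have h33 : ContDiff ℝ 2 fun y : Pt => -(y 1 ^ 2 + a ^ 2) := by fun_prop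
  fin_cases i <;> fin_cases j <;> first | exact h03 | exact h33 | exact contDiff_const

theorem contDiffOn_frameNorm (hM : ContDiffOn ℝ 2 M I) (i : Fin 4) :
    ContDiffOn ℝ 2 (fun y => frameNorm a M y i) (domain a M I) := by
  have hM_comp : ContDiffOn ℝ 2 (fun y : Pt => M (y 1)) (domain a M I) :=
    hM.comp (contDiff_apply ℝ ℝ 1).contDiffOn fun _ hx => hx.1
  have hr : ContDiffOn ℝ 2 (fun y : Pt => y 1) (domain a M I) := by fun_prop
  have hDel : ContDiffOn ℝ 2 (Del a M) (domain a M I) :=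
    ((hr.pow 2).sub ((contDiffOn_const.mul hM_comp).mul hr)).add contDiffOn_const
  have hSig : ContDiffOn ℝ 2 (Sig a) (domain a M I) := by
    unfold Sig
    fun_prop
  have hsin : ContDiffOn ℝ 2 (fun y : Pt => Real.sin (y 2) ^ 2) (domain a M I) := by fun_prop
  fin_cases i
  · exact (hDel.div hSig fun _ hx => hx.2.2.1).neg
  · exact hSig.div hDel fun _ hx => hx.2.2.2
  · exact hSig
  · exact hsin.div hSig fun _ hx => hx.2.2.1

theorem connection_add_transpose (a : ℝ) (M : ℝ → ℝ) (c : Fin 4) (x : Pt) :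
    connection a M c x + (connection a M c x)ᵀ = diagonal (frameNormDeriv a M c x) := by
  rw [connection, transpose_add, diagonal_transpose, skewMatrix_transpose, add_add_add_comm,
    add_neg_cancel, add_zero, diagonal_add]
  congr 1
  funext i
  simp only [Pi.smul_apply, smul_eq_mul]
  ring

theorem isCoframeConnection_connection (hI : IsOpen I) (hM : ContDiffOn ℝ 2 M I) :
    IsCoframeConnection (coframe a) (fun y => diagonal (frameNorm a M y)) (coframeDeriv a)
      (connection a M) (domain a M I) where
  det_coframe_ne_zero x hx := det_coframe a x ▸ neg_ne_zero.2 hx.2.2.1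
  det_frameMetric_ne_zero _ hx := det_frameNorm_ne_zero hx
  frameMetric_symm _ _ := diagonal_transpose _
  hasPd_coframe _ _ _ := hasPd_coframe
  hasPd_frameMetric x hx c := by
    rw [connection_add_transpose]
    exact hasPd_diagonal (hasPd_frameNorm hx.2.2.1 hx.2.2.2
      ((hM.differentiableOn two_ne_zero).differentiableAt (hI.mem_nhds hx.1)))
  torsionFree _ hx := connection_torsionFree hx.2.2.1 hx.2.2.2

theorem exists_hasPd_connection (hI : IsOpen I) (hM : ContDiffOn ℝ 2 M I)
    (hx : x ∈ domain a M I) :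
    ∃ h₂ : Fin 4 → Fin 4 → Mat, (∀ c d, h₂ c d = h₂ d c) ∧ ∀ c d,
      HasPd c (connection a M d) (h₂ c d + skewMatrix (spinDeriv a M c d x)) x := by
  have hC2 : ∀ i j, ContDiffOn ℝ 2 (fun y => diagonal (frameNorm a M y) i j) (domain a M I) := by
    intro i j
    rcases eq_or_ne i j with rfl | hij
    · simpa only [diagonal_apply_eq] using contDiffOn_frameNorm hM i
    · simpa only [diagonal_apply_ne _ hij] using contDiffOn_const
  have hM₁ : ∀ y ∈ domain a M I, DifferentiableAt ℝ M (y 1) := fun y hy =>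
    (hM.differentiableOn two_ne_zero).differentiableAt (hI.mem_nhds hy.1)
  have hM₂ : DifferentiableAt ℝ (deriv M) (x 1) :=
    ((hM.deriv_of_isOpen hI one_add_one_eq_two.le).differentiableOn one_ne_zero).differentiableAt
      (hI.mem_nhds hx.1)
  obtain ⟨A₂, A₂_symm, hA₂⟩ := exists_symmetric_hasPd_hasPd
    (isOpen_domain hI hM.continuousOn) hC2 (fun y hy c =>
      hasPd_diagonal (c := c) (hasPd_frameNorm hy.2.2.1 hy.2.2.2 (hM₁ y hy))) hx
  refine ⟨fun c d => (1 / 2 : ℝ) • A₂ c d, fun c d => congrArg _ (A₂_symm c d), fun c d => ?_⟩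
  refine HasPd.matrix_add (hasPd_matrix.2 fun i j => ?_)
    (hasPd_skewMatrix (hasPd_spin hx.2.2.1 hx.2.2.2 (hM₁ x hx) hM₂ d))
  simpa only [diagonal_smul, Matrix.smul_apply, smul_eq_mul] using
    (hasPd_matrix.1 (hA₂ c d) i j).const_mul (1 / 2)

theorem riemann_metric (hI : IsOpen I) (hM : ContDiffOn ℝ 2 M I) (hx : x ∈ domain a M I)
    (i j c d : Fin 4) :
    riemann (metric a M) x i j c d =
      ((coframe a x)ᵀ * skewMatrix (curvatureForm a M x c d) * coframe a x) i j := by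
  obtain ⟨h₂, h₂_symm, h₂_hasPd⟩ := exists_hasPd_connection hI hM hx
  have hcurv := (isCoframeConnection_connection (a := a) hI hM).riemann_eq
    (isOpen_domain hI hM.continuousOn) (fun i j => (contDiff_coframe a i j).contDiffOn) hx h₂_hasPd
    i j c d
  rw [← connectionCurvature_eq hx.2.2.1 hx.2.2.2 (sin_ne_zero hx), funext (metric_eq_coframe a M),
    hcurv, connectionCurvature, h₂_symm d c, add_sub_add_left_eq_sub]

end KerrRiemann

section KerrTetrad

variable {a : ℝ} {M : ℝ → ℝ} {I : Set ℝ} {x : Pt}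

/-- The components in the coframe `coframe` of a complex vector given in coordinates. -/
def frameComponents (a : ℝ) (x : Pt) (u : Fin 4 → ℂ) : Fin 4 → ℂ :=
  (coframe a x).map Complex.ofReal *ᵥ u

theorem dotC_metric (u v : Fin 4 → ℂ) :
    dotC (metric a M x) u v =
      ∑ i, frameNorm a M x i * (frameComponents a x u i * frameComponents a x v i) := by
  have hmap : (metric a M x).map Complex.ofReal = ((coframe a x).map Complex.ofReal)ᵀ
      * diagonal (fun i => (frameNorm a M x i : ℂ)) * (coframe a x).map Complex.ofReal := by
    ext i j
    rw [map_apply, metric_eq_coframe, transpose_mul_diagonal_mul_apply, mul_apply]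
    simp only [mul_diagonal, transpose_apply, map_apply, Complex.ofReal_sum, Complex.ofReal_mul]
    exact Finset.sum_congr rfl fun k _ => by ring
  rw [dotC_eq_dotProduct, hmap, ← mulVec_mulVec, ← mulVec_mulVec, dotProduct_mulVec,
    vecMul_transpose, dotProduct]
  refine Finset.sum_congr rfl fun i _ => ?_
  rw [mulVec_diagonal, frameComponents, frameComponents]
  ring

theorem frameComponents_conjVec (u : Fin 4 → ℂ) :
    frameComponents a x (conjVec u) = conjVec (frameComponents a x u) := by
  funext i
  simp only [frameComponents, conjVec, mulVec, dotProduct, map_apply, map_sum, map_mul,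
    Complex.conj_ofReal]

theorem frameComponents_single (b i : Fin 4) :
    frameComponents a x (Pi.single b 1) i = coframe a x i b := by
  rw [frameComponents, mulVec_single_one, col_apply, map_apply]

theorem ofReal_Sig (a : ℝ) (x : Pt) :
    (Sig a x : ℂ) = x 1 ^ 2 + a ^ 2 - a ^ 2 * Complex.sin (x 2) ^ 2 := by
  rw [Sig, Real.cos_sq']
  push_cast
  ring

theorem frameComponents_vecL (hD : Del a M x ≠ 0) :
    frameComponents a x (toC (vecL a M x)) = ![(Sig a x : ℂ) / Del a M x, 1, 0, 0] := by
  have hD' : (Del a M x : ℂ) ≠ 0 := by exact_mod_cast hD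
  funext i
  fin_cases i <;>
    simp [frameComponents, coframe, formT, formR, formTheta, formPhi, toC, vecL, mulVec, dotProduct,
      Fin.sum_univ_four, ofReal_Sig] <;> field_simp <;> ring

theorem frameComponents_vecK (hS : Sig a x ≠ 0) :
    frameComponents a x (toC (vecK a M x)) =
      ![1 / 2, -(Del a M x : ℂ) / (2 * Sig a x), 0, 0] := by
  have hS₀ : (Sig a x : ℂ) ≠ 0 := by exact_mod_cast hS
  rw [ofReal_Sig] at hS₀ ⊢
  funext i
  fin_cases i <;>
    simp [frameComponents, coframe, formT, formR, formTheta, formPhi, toC, vecK, mulVec, dotProduct,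
      Fin.sum_univ_four, ofReal_Sig] <;> field_simp <;> ring

theorem rhoC_mul_rhoBar (a : ℝ) (x : Pt) : rhoC a x * rhoBar a x = Sig a x := by
  simp only [rhoC, rhoBar, Sig]
  push_cast
  linear_combination -(a ^ 2 * Complex.cos (x 2) ^ 2) * Complex.I_sq

theorem conj_rhoC (a : ℝ) (x : Pt) : conj (rhoC a x) = rhoBar a x := by
  simp [rhoC, rhoBar, -Complex.ofReal_cos, Complex.conj_ofReal]
  ring

/-- The factor `1 / (√2 ϱ)` of `m`. -/
def polarFactor (a : ℝ) (x : Pt) : ℂ := 1 / ((Real.sqrt 2 : ℂ) * rhoC a x)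

theorem polarFactor_mul_conj (a : ℝ) (x : Pt) :
    polarFactor a x * conj (polarFactor a x) = 1 / (2 * Sig a x) := by
  have hsqrt : (Real.sqrt 2 : ℂ) ^ 2 = 2 := by
    rw [← Complex.ofReal_pow, Real.sq_sqrt zero_le_two, Complex.ofReal_ofNat]
  rw [polarFactor, map_div₀, map_one, map_mul, Complex.conj_ofReal, conj_rhoC, ← rhoC_mul_rhoBar,
    ← hsqrt]
  ring

theorem frameComponents_vecM (hs : Real.sin (x 2) ≠ 0) :
    frameComponents a x (vecM a x) =
      polarFactor a x • ![0, 0, 1, -(Complex.I * Sig a x / Real.sin (x 2))] := by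
  have hs' : Complex.sin (x 2) ≠ 0 := by exact_mod_cast hs
  rw [vecM, frameComponents, mulVec_smul, polarFactor]
  congr 1
  funext i
  fin_cases i <;>
    simp [coframe, formT, formR, formTheta, formPhi, mulVec, dotProduct, Fin.sum_univ_four,
      ofReal_Sig] <;>
    field_simp <;> ring

theorem frameComponents_conjVec_vecM (hs : Real.sin (x 2) ≠ 0) :
    frameComponents a x (conjVec (vecM a x)) =
      conj (polarFactor a x) • ![0, 0, 1, Complex.I * Sig a x / Real.sin (x 2)] := by
  rw [frameComponents_conjVec, frameComponents_vecM hs]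
  funext i
  fin_cases i <;> simp [conjVec, -Complex.ofReal_sin, neg_div]

theorem isNullTetrad_kerr (hx : x ∈ domain a M I) :
    IsNullTetrad (metric a M x) (vecL a M x) (vecK a M x) (vecM a x) := by
  obtain ⟨-, -, hS, hD⟩ := id hx
  have hs := sin_ne_zero hx
  have hS' : (Sig a x : ℂ) ≠ 0 := by exact_mod_cast hS
  have hD' : (Del a M x : ℂ) ≠ 0 := by exact_mod_cast hD
  have hs' : Complex.sin (x 2) ≠ 0 := by exact_mod_cast hs
  simp only [IsNullTetrad, dotC_metric, frameComponents_vecL hD, frameComponents_vecK hS,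
    frameComponents_vecM hs, frameComponents_conjVec_vecM hs, Fin.sum_univ_four]
  have hμ := polarFactor_mul_conj a x
  set μ := polarFactor a x
  refine ⟨?_, ?_, ?_, ?_, ?_, ?_, ?_, ?_, ?_, ?_⟩ <;> simp [frameNorm]
  · field_simp
    ring
  · field_simp
    ring
  · field_simp
    linear_combination (μ ^ 2 * Sig a x) * Complex.I_sq
  · field_simp
    linear_combination (conj μ ^ 2 * Sig a x) * Complex.I_sq
  · field_simp
    ring
  · field_simp at hμ ⊢
    linear_combination hμ - (μ * conj μ * Sig a x) * Complex.I_sq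

end KerrTetrad

section KerrWeyl

variable {a : ℝ} {M : ℝ → ℝ} {I : Set ℝ} {x : Pt}

theorem transpose_mul_skewMatrix_mul_apply (Θ : Mat) (w : Fin 6 → ℝ) (i j : Fin 4) :
    (Θᵀ * skewMatrix w * Θ) i j =
      w 0 * area Θ 0 1 i j + w 1 * area Θ 0 2 i j + w 2 * area Θ 0 3 i j
        + w 3 * area Θ 1 2 i j + w 4 * area Θ 1 3 i j + w 5 * area Θ 2 3 i j := by
  simp only [skewMatrix, mul_apply, transpose_apply, of_apply, cons_val', cons_val_fin_one,
    Fin.sum_univ_four, cons_val_zero, cons_val_one, cons_val, mul_zero, mul_neg, zero_add, add_zero,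
    area]
  ring

theorem kulkarniNomizu_transpose_mul_diagonal_mul (Θ : Mat) (h w : Fin 4 → ℝ) (b c d e : Fin 4) :
    kulkarniNomizu (Θᵀ * diagonal h * Θ) (Θᵀ * diagonal w * Θ) b c d e =
      ∑ i, ∑ j, h i * w j * (area Θ i j b c * area Θ i j d e) := by
  simp only [kulkarniNomizu, transpose_mul_diagonal_mul_apply, Finset.sum_mul_sum,
    ← Finset.sum_add_distrib, ← Finset.sum_sub_distrib, area]
  exact Finset.sum_congr rfl fun i _ => Finset.sum_congr rfl fun j _ => by ring

theorem bivector_metric_single (u v : Fin 4 → ℂ) (b c : Fin 4) :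
    bivector (metric a M x) u v (Pi.single b 1) (Pi.single c 1) =
      ∑ i, ∑ j, (frameNorm a M x i * frameComponents a x u i)
        * (frameNorm a M x j * frameComponents a x v j) * area (coframe a x) i j b c := by
  simp only [bivector, dotC_metric, frameComponents_single, Finset.sum_mul_sum,
    ← Finset.sum_sub_distrib, area, Complex.ofReal_sub, Complex.ofReal_mul]
  exact Finset.sum_congr rfl fun i _ => Finset.sum_congr rfl fun j _ => by ring

theorem bivector_vecL_vecK (hS : Sig a x ≠ 0) (hD : Del a M x ≠ 0) (b c : Fin 4) :
    bivector (metric a M x) (toC (vecL a M x)) (toC (vecK a M x)) (Pi.single b 1) (Pi.single c 1) =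
      area (coframe a x) 0 1 b c := by
  have hS' : (Sig a x : ℂ) ≠ 0 := by exact_mod_cast hS
  have hD' : (Del a M x : ℂ) ≠ 0 := by exact_mod_cast hD
  simp only [bivector_metric_single, frameNorm, frameComponents_vecL hD, frameComponents_vecK hS,
    one_div, area, Complex.ofReal_sub, Complex.ofReal_mul, Fin.sum_univ_four, cons_val_zero,
    Complex.ofReal_neg, Complex.ofReal_div, neg_mul, mul_neg, cons_val_one, cons_val, mul_zero,
    zero_mul, add_zero, Complex.ofReal_pow, Complex.ofReal_sin, neg_neg, mul_one, neg_zero]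
  field_simp
  ring

theorem bivector_vecM_conjVec (hS : Sig a x ≠ 0) (hs : Real.sin (x 2) ≠ 0) (b c : Fin 4) :
    bivector (metric a M x) (vecM a x) (conjVec (vecM a x)) (Pi.single b 1) (Pi.single c 1) =
      Complex.I * (Real.sin (x 2) * area (coframe a x) 2 3 b c) := by
  have hS' : (Sig a x : ℂ) ≠ 0 := by exact_mod_cast hS
  have hμ := polarFactor_mul_conj a x
  simp only [bivector_metric_single, frameNorm, frameComponents_vecM hs, Complex.ofReal_sin,
    Pi.smul_apply, smul_eq_mul, frameComponents_conjVec_vecM hs, area, Complex.ofReal_sub,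
    Complex.ofReal_mul, Fin.sum_univ_four, cons_val_zero, Complex.ofReal_neg, Complex.ofReal_div,
    mul_zero, zero_mul, cons_val_one, add_zero, cons_val, mul_one, zero_add, Complex.ofReal_pow,
    mul_neg, neg_mul]
  set μ := polarFactor a x
  field_simp at hμ ⊢
  linear_combination Complex.sin (x 2) * Complex.I * ((coframe a x 2 b : ℂ) * coframe a x 3 c
    - coframe a x 2 c * coframe a x 3 b) * hμ

theorem bivector_conjVec_vecM_vecK (hS : Sig a x ≠ 0) (hD : Del a M x ≠ 0)
    (hs : Real.sin (x 2) ≠ 0) (b c : Fin 4) :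
    bivector (metric a M x) (conjVec (vecM a x)) (toC (vecK a M x)) (Pi.single b 1)
        (Pi.single c 1) =
      conj (polarFactor a x) / 2 * (Del a M x * area (coframe a x) 0 2 b c
        + Sig a x * area (coframe a x) 1 2 b c
        + Complex.I * Real.sin (x 2) * (Del a M x / Sig a x * area (coframe a x) 0 3 b c
          + area (coframe a x) 1 3 b c)) := by
  have hS' : (Sig a x : ℂ) ≠ 0 := by exact_mod_cast hS
  have hD' : (Del a M x : ℂ) ≠ 0 := by exact_mod_cast hD
  simp only [bivector_metric_single, frameNorm, frameComponents_conjVec_vecM hs, Complex.ofReal_sin,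
    Pi.smul_apply, smul_eq_mul, frameComponents_vecK hS, one_div, area, Complex.ofReal_sub,
    Complex.ofReal_mul, Fin.sum_univ_four, cons_val_zero, Complex.ofReal_neg, Complex.ofReal_div,
    neg_mul, mul_neg, cons_val_one, cons_val, mul_zero, zero_mul, add_zero, Complex.ofReal_pow,
    neg_zero, mul_one, zero_add]
  field_simp
  ring

theorem bivector_vecL_vecM (hS : Sig a x ≠ 0) (hD : Del a M x ≠ 0) (hs : Real.sin (x 2) ≠ 0)
    (b c : Fin 4) :
    bivector (metric a M x) (toC (vecL a M x)) (vecM a x) (Pi.single b 1) (Pi.single c 1) =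
      polarFactor a x * (-Sig a x * area (coframe a x) 0 2 b c
        + Sig a x ^ 2 / Del a M x * area (coframe a x) 1 2 b c
        + Complex.I * Real.sin (x 2) * (area (coframe a x) 0 3 b c
          - Sig a x / Del a M x * area (coframe a x) 1 3 b c)) := by
  have hS' : (Sig a x : ℂ) ≠ 0 := by exact_mod_cast hS
  have hD' : (Del a M x : ℂ) ≠ 0 := by exact_mod_cast hD
  simp only [bivector_metric_single, frameNorm, frameComponents_vecL hD, frameComponents_vecM hs,
    Complex.ofReal_sin, Pi.smul_apply, smul_eq_mul, area, Complex.ofReal_sub, Complex.ofReal_mul,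
    Fin.sum_univ_four, cons_val_zero, Complex.ofReal_neg, Complex.ofReal_div, mul_zero, zero_mul,
    cons_val_one, add_zero, cons_val, mul_one, zero_add, Complex.ofReal_pow, mul_neg, neg_mul,
    neg_neg, neg_zero]
  field_simp
  ring

theorem selfDualTypeD_kerr (hx : x ∈ domain a M I) (b c d e : Fin 4) :
    let S := Sig a x
    let D := Del a M x
    let s := Real.sin (x 2)
    let E := fun i j => area (coframe a x) i j b c
    let F := fun i j => area (coframe a x) i j d e
    selfDualTypeD (metric a M x) (toC (vecL a M x)) (toC (vecK a M x)) (vecM a x)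
        (conjVec (vecM a x)) (Pi.single b 1) (Pi.single c 1) (Pi.single d 1) (Pi.single e 1) =
      ((E 0 1 * F 0 1 - s ^ 2 * (E 2 3 * F 2 3)
          + (-D * (E 0 2 * F 0 2) - D * s ^ 2 / S ^ 2 * (E 0 3 * F 0 3)
            + S ^ 2 / D * (E 1 2 * F 1 2) + s ^ 2 / D * (E 1 3 * F 1 3)) / 2 : ℝ) : ℂ)
        - Complex.I * (s * (E 0 1 * F 2 3 + E 2 3 * F 0 1
          + (E 0 2 * F 1 3 + E 1 3 * F 0 2 - E 0 3 * F 1 2 - E 1 2 * F 0 3) / 2) : ℝ) := by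
  intro S D s E F
  obtain ⟨-, -, hS, hD⟩ := id hx
  have hs := sin_ne_zero hx
  have hS' : (Sig a x : ℂ) ≠ 0 := by exact_mod_cast hS
  have hD' : (Del a M x : ℂ) ≠ 0 := by exact_mod_cast hD
  have hnull : ∀ u₁ u₂ v₁ v₂ : ℂ,
      conj (polarFactor a x) / 2 * (u₁ + Complex.I * Real.sin (x 2) * u₂)
        * (polarFactor a x * (v₁ + Complex.I * Real.sin (x 2) * v₂)) =
      (u₁ * v₁ - Real.sin (x 2) ^ 2 * (u₂ * v₂)
        + Complex.I * (Real.sin (x 2) * (u₁ * v₂ + u₂ * v₁))) / (4 * Sig a x) := by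
    intro u₁ u₂ v₁ v₂
    linear_combination ((u₁ + Complex.I * Real.sin (x 2) * u₂)
      * (v₁ + Complex.I * Real.sin (x 2) * v₂) / 2) * polarFactor_mul_conj a x
        + (Real.sin (x 2) ^ 2 * (u₂ * v₂) / (4 * Sig a x)) * Complex.I_sq
  have hW : ∀ u v : ℂ,
      (Complex.I * (s * u) - E 0 1) * (Complex.I * (s * v) - F 0 1) =
        E 0 1 * F 0 1 - s ^ 2 * (u * v) - Complex.I * (s * (E 0 1 * v + u * F 0 1)) := by
    intro u v
    linear_combination (s ^ 2 * (u * v)) * Complex.I_sq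
  rw [selfDualTypeD, mul_comm (bivector _ (toC (vecL a M x)) (vecM a x) _ _)]
  simp only [bivector_vecL_vecK hS hD, bivector_vecM_conjVec hS hs,
    bivector_conjVec_vecM_vecK hS hD hs, bivector_vecL_vecM hS hD hs, hnull]
  rw [hW]
  simp only [S, D, s, E, F]
  push_cast
  field_simp
  ring

/-- `Ψ₂` of the Kerr-like metric, assembled from its real and imaginary parts. -/
def psi2 (a : ℝ) (M : ℝ → ℝ) (x : Pt) : ℂ := ⟨psi2Re a M x, psi2Im a M x⟩

/-- The tensor `P` with `Riemann = Weyl + (1/2) g ∧ P` (Kulkarni–Nomizu product), which is diagonal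
in the coframe. -/
def schouten (a : ℝ) (M : ℝ → ℝ) (x : Pt) : Mat :=
  (coframe a x)ᵀ * diagonal (![schoutenRadial a M x, schoutenRadial a M x, schoutenAngular a M x,
    schoutenAngular a M x] * frameNorm a M x) * coframe a x

theorem riemann_metric_eq (hI : IsOpen I) (hM : ContDiffOn ℝ 2 M I) (hx : x ∈ domain a M I) :
    riemann (metric a M) x =
      typeDTensor (metric a M x) (vecL a M x) (vecK a M x) (vecM a x) (psi2 a M x)
        + (1 / 2 : ℝ) • kulkarniNomizu (metric a M x) (schouten a M x) := by
  obtain ⟨-, -, hS, hD⟩ := id hx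
  have hflip : ∀ i j b c, area (coframe a x) j i b c = -area (coframe a x) i j b c := by
    intro i j b c
    simp only [area]
    ring
  have hself : ∀ i b c, area (coframe a x) i i b c = 0 := fun i b c => by
    simp only [area]
    ring
  funext b c d e
  simp only [Pi.add_apply, Pi.smul_apply, smul_eq_mul, typeDTensor, selfDualTypeD_kerr hx]
  rw [riemann_metric hI hM hx, transpose_mul_skewMatrix_mul_apply, metric_eq_coframe, schouten,
    kulkarniNomizu_transpose_mul_diagonal_mul]
  simp only [curvatureForm, mul_neg, neg_mul, cons_val_zero, cons_val_one, cons_val, psi2,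
    Complex.mul_re, Complex.sub_re, Complex.ofReal_re, Complex.I_re, zero_mul, Complex.I_im,
    Complex.ofReal_im, mul_zero, sub_self, sub_zero, Complex.sub_im, Complex.mul_im, one_mul,
    zero_add, zero_sub, sub_neg_eq_add, one_div, frameNorm, Pi.mul_apply, Fin.sum_univ_four, hself,
    neg_zero, hflip 0 1, neg_neg, add_zero, hflip 0 2, hflip 1 2, hflip 0 3, hflip 1 3, hflip 2 3]
  field_simp
  ring

theorem weyl_metric (hI : IsOpen I) (hM : ContDiffOn ℝ 2 M I) (hx : x ∈ domain a M I) :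
    weyl (metric a M) x =
      typeDTensor (metric a M x) (vecL a M x) (vecK a M x) (vecM a x) (psi2 a M x) :=
  weyl_eq_of_riemann_eq (det_metric_ne_zero hx) (metric_symm a M x) (riemann_metric_eq hI hM hx)
    (ricciTrace_typeDTensor (metric_symm a M x) (isNullTetrad_kerr hx) _)

end KerrWeyl

section KerrPsi2

variable {a : ℝ} {M : ℝ → ℝ} {I : Set ℝ} {x y : Pt}

/-- The numerator of `Ψ₂`, up to sign. -/
def psi2Num (a : ℝ) (M : ℝ → ℝ) (x : Pt) : ℂ :=
  6 * rhoC a x * (M (x 1) : ℂ)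
    - 2 * ((x 1 : ℂ) + rhoC a x) * rhoBar a x * ((deriv M (x 1) : ℝ) : ℂ)
    + (x 1 : ℂ) * rhoBar a x ^ 2 * ((deriv (deriv M) (x 1) : ℝ) : ℂ)

theorem rhoC_ne_zero (hS : Sig a x ≠ 0) : rhoC a x ≠ 0 :=
  left_ne_zero_of_mul (b := rhoBar a x) (by rw [rhoC_mul_rhoBar]; exact_mod_cast hS)

theorem rhoBar_ne_zero (hS : Sig a x ≠ 0) : rhoBar a x ≠ 0 :=
  right_ne_zero_of_mul (a := rhoC a x) (by rw [rhoC_mul_rhoBar]; exact_mod_cast hS)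

theorem psi2_eq (hS : Sig a x ≠ 0) :
    psi2 a M x = -(psi2Num a M x / (6 * rhoC a x * rhoBar a x ^ 3)) := by
  have hρ := rhoC_ne_zero hS
  have hρ' := rhoBar_ne_zero hS
  have hS' : (Sig a x : ℂ) ≠ 0 := by exact_mod_cast hS
  have hpsi2 : psi2 a M x = -(12 * rhoC a x ^ 2 * (x 1 * M (x 1))
      - 6 * Sig a x * rhoC a x * (M (x 1) + x 1 * deriv M (x 1))
      + Sig a x ^ 2 * (2 * deriv M (x 1) + x 1 * deriv (deriv M) (x 1))) / (6 * Sig a x ^ 3) := by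
    rw [psi2, Complex.mk_eq_add_mul_I, psi2Re, psi2Im, rhoC]
    push_cast
    field_simp
    linear_combination (12 * (a * Complex.cos (x 2)) ^ 2 * (x 1 * M (x 1))) * Complex.I_sq
  have hr : (x 1 : ℂ) = (rhoC a x + rhoBar a x) / 2 := by
    simp only [rhoC, rhoBar]
    ring
  rw [hpsi2, ← rhoC_mul_rhoBar, psi2Num, hr]
  field_simp
  ring

theorem kerrPsi2_eq (hI : IsOpen I) (hM : ContDiffOn ℝ 2 M I) (hx : x ∈ domain a M I) :
    kerrPsi2 a M x = psi2 a M x := by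
  rw [kerrPsi2, weyl_metric hI hM hx]
  exact (psi_typeDTensor (metric_symm a M x) (isNullTetrad_kerr hx) _).2.2.1

theorem kerrPsi2_eq_zero_iff (hI : IsOpen I) (hM : ContDiffOn ℝ 2 M I) (hx : x ∈ domain a M I) :
    kerrPsi2 a M x = 0 ↔ psi2Num a M x = 0 := by
  obtain ⟨-, -, hS, -⟩ := id hx
  rw [kerrPsi2_eq hI hM hx, psi2_eq hS]
  simp only [neg_eq_zero, div_eq_zero_iff, mul_eq_zero, pow_eq_zero_iff three_ne_zero,
    rhoC_ne_zero hS, rhoBar_ne_zero hS, OfNat.ofNat_ne_zero, or_false]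

theorem continuousOn_psi2Num (hI : IsOpen I) (hM : ContDiffOn ℝ 2 M I) :
    ContinuousOn (psi2Num a M) (domain a M I) := by
  have hM' : ContDiffOn ℝ 1 (deriv M) I := hM.deriv_of_isOpen hI (by norm_num)
  have hM'' : ContDiffOn ℝ 0 (deriv (deriv M)) I := hM'.deriv_of_isOpen hI (by norm_num)
  have hradial : ∀ f : ℝ → ℝ, ContinuousOn f I →
      ContinuousOn (fun x : Pt => ((f (x 1) : ℝ) : ℂ)) (domain a M I) := fun f hf =>
    Complex.continuous_ofReal.comp_continuousOn
      (hf.comp (continuous_apply 1).continuousOn fun x hx => hx.1)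
  have h₀ := hradial M hM.continuousOn
  have h₁ := hradial _ hM'.continuousOn
  have h₂ := hradial _ hM''.continuousOn
  unfold psi2Num rhoC rhoBar
  fun_prop

theorem isOpen_kerrPsi2_ne_zero (hI : IsOpen I) (hM : ContDiffOn ℝ 2 M I) :
    IsOpen {x ∈ domain a M I | kerrPsi2 a M x ≠ 0} := by
  convert (continuousOn_psi2Num (a := a) hI hM).isOpen_inter_preimage
    (isOpen_domain hI hM.continuousOn) (isOpen_compl_singleton (x := (0 : ℂ))) using 1
  ext x
  exact and_congr_right fun hx => not_congr (kerrPsi2_eq_zero_iff hI hM hx)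

theorem psi2Num_re (a : ℝ) (M : ℝ → ℝ) (x : Pt) :
    (psi2Num a M x).re = 6 * x 1 * M (x 1)
      - 2 * (2 * x 1 ^ 2 + a ^ 2 * Real.cos (x 2) ^ 2) * deriv M (x 1)
      + x 1 * (x 1 ^ 2 - a ^ 2 * Real.cos (x 2) ^ 2) * deriv (deriv M) (x 1) := by
  simp only [psi2Num, rhoC, Complex.ofReal_mul, rhoBar, pow_two, Complex.add_re, Complex.sub_re,
    Complex.mul_re, Complex.re_ofNat, Complex.ofReal_re, Complex.I_re, Complex.ofReal_im, mul_zero,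
    sub_zero, zero_mul, Complex.I_im, Complex.mul_im, add_zero, sub_self, Complex.im_ofNat,
    Complex.add_im, one_mul, zero_add, Complex.sub_im, zero_sub, mul_neg, sub_neg_eq_add, neg_mul,
    neg_neg]
  ring

theorem psi2Num_im (a : ℝ) (M : ℝ → ℝ) (x : Pt) :
    (psi2Num a M x).im = 2 * (a * Real.cos (x 2)) * (3 * M (x 1) + x 1 * deriv M (x 1)
      - x 1 ^ 2 * deriv (deriv M) (x 1)) := by
  simp only [psi2Num, rhoC, Complex.ofReal_mul, rhoBar, pow_two, Complex.add_im, Complex.sub_im,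
    Complex.mul_im, Complex.mul_re, Complex.re_ofNat, Complex.add_re, Complex.ofReal_re,
    Complex.I_re, Complex.ofReal_im, mul_zero, sub_zero, zero_mul, Complex.I_im, add_zero, sub_self,
    Complex.im_ofNat, one_mul, zero_add, Complex.sub_re, zero_sub, mul_neg, sub_neg_eq_add, neg_mul,
    neg_neg]
  ring

theorem mass_eq_zero_of_psi2Num_eq_zero (ha : a ≠ 0) (hxy : x 1 = y 1) (hr : y 1 ≠ 0)
    (hcos : Real.cos (x 2) ^ 2 ≠ Real.cos (y 2) ^ 2) (hx : psi2Num a M x = 0)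
    (hy : psi2Num a M y = 0) : M (y 1) = 0 := by
  have hre_x := psi2Num_re a M x
  have hre_y := psi2Num_re a M y
  have him_x := psi2Num_im a M x
  have him_y := psi2Num_im a M y
  rw [hx, hxy] at hre_x him_x
  rw [hy] at hre_y him_y
  simp only [Complex.zero_re, Complex.zero_im] at hre_x hre_y him_x him_y
  set r := y 1
  set m := M r
  set m' := deriv M r
  set m'' := deriv (deriv M) r
  set u := Real.cos (x 2)
  set v := Real.cos (y 2)
  have hcoeff : 2 * m' + r * m'' = 0 := by
    have hdiff : a ^ 2 * (u ^ 2 - v ^ 2) * (2 * m' + r * m'') = 0 := by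
      linear_combination hre_x - hre_y
    simpa [ha, sub_ne_zero.mpr hcos] using hdiff
  have hconst : 6 * m - 4 * r * m' + r ^ 2 * m'' = 0 := by
    have hmul : r * (6 * m - 4 * r * m' + r ^ 2 * m'') = 0 := by
      linear_combination -hre_x + a ^ 2 * u ^ 2 * hcoeff
    simpa [hr] using hmul
  have him : 3 * m + r * m' - r ^ 2 * m'' = 0 := by
    by_cases hu : u = 0
    · have hv : v ≠ 0 := fun hv => hcos (by rw [hu, hv])
      simpa [ha, hv] using him_y.symm
    · simpa [ha, hu] using him_x.symm
  linear_combination (1 / 12) * hconst + (1 / 6) * him + (1 / 12) * r * hcoeff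

theorem exists_cos_sq_ne {U : Set ℝ} (hU : IsOpen U) (hne : U.Nonempty)
    (hsub : U ⊆ Set.Icc 0 Real.pi) (c : ℝ) : ∃ θ ∈ U, Real.cos θ ^ 2 ≠ c := by
  by_contra! hconst
  obtain ⟨θ₀, hθ₀⟩ := hne
  have hfinite : {u : ℝ | u ^ 2 = c}.Finite :=
    (Set.toFinite {Real.cos θ₀, -Real.cos θ₀}).subset fun u hu =>
      sq_eq_sq_iff_eq_or_eq_neg.1 (hu.trans (hconst θ₀ hθ₀).symm)
  exact infinite_of_mem_nhds θ₀ (hU.mem_nhds hθ₀)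
    ((Set.Finite.of_finite_image (hfinite.subset (Set.image_subset_iff.2 hconst)))
      (Real.injOn_cos.mono hsub))

theorem exists_psi2Num_ne_zero (ha : a ≠ 0) {W : Set Pt} (hW : IsOpen W) (hne : W.Nonempty)
    (hangle : ∀ y ∈ W, y 2 ∈ Set.Ioo 0 Real.pi) (hmass : ∀ y ∈ W, M (y 1) ≠ 0) :
    ∃ y ∈ W, psi2Num a M y ≠ 0 := by
  have hslice : ∀ (i : Fin 4) (y : Pt), IsOpen {s : ℝ | Function.update y i s ∈ W} := fun i y =>
    hW.preimage (by fun_prop)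
  obtain ⟨x, hx⟩ := hne
  obtain ⟨r, hr, hr₀⟩ := (dense_compl_singleton (0 : ℝ)).inter_open_nonempty _ (hslice 1 x)
    ⟨x 1, by rwa [Set.mem_ofPred_eq, Function.update_eq_self]⟩
  set y := Function.update x 1 r
  have hyr : y 1 = r := Function.update_self 1 r x
  obtain ⟨θ, hθ, hcos⟩ := exists_cos_sq_ne (hslice 2 y)
    ⟨y 2, by rwa [Set.mem_ofPred_eq, Function.update_eq_self]⟩
    (fun s hs => by simpa using Set.Ioo_subset_Icc_self (hangle _ hs)) (Real.cos (y 2) ^ 2)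
  by_contra! hzero
  refine hmass y hr (mass_eq_zero_of_psi2Num_eq_zero (x := Function.update y 2 θ) ha ?_
    (hyr ▸ hr₀) ?_ (hzero _ hθ) (hzero y hr))
  · exact Function.update_of_ne (by decide : (1 : Fin 4) ≠ 2) θ y
  · rwa [Function.update_self]

theorem mass_ne_zero_subset_closure (ha : a ≠ 0) (hI : IsOpen I) (hM : ContDiffOn ℝ 2 M I) :
    {x ∈ domain a M I | M (x 1) ≠ 0} ⊆ closure {x ∈ domain a M I | kerrPsi2 a M x ≠ 0} := by
  intro x hx
  have hmass : ContinuousOn (fun y : Pt => M (y 1)) (domain a M I) :=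
    hM.continuousOn.comp (continuous_apply 1).continuousOn fun y hy => hy.1
  have hopen : IsOpen (domain a M I ∩ (fun y : Pt => M (y 1)) ⁻¹' {0}ᶜ) :=
    hmass.isOpen_inter_preimage (isOpen_domain hI hM.continuousOn) isOpen_compl_singleton
  refine mem_closure_iff.2 fun V hV hxV => ?_
  obtain ⟨y, hy, hy₀⟩ := exists_psi2Num_ne_zero (M := M) ha (hV.inter hopen) ⟨x, hxV, hx⟩
    (fun y hy => hy.2.1.2.1) fun y hy => hy.2.2
  exact ⟨y, hy.1, hy.2.1, (kerrPsi2_eq_zero_iff hI hM hy.2.1).not.2 hy₀⟩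

theorem hasDoublePNDPair_kerr (hI : IsOpen I) (hM : ContDiffOn ℝ 2 M I) (hx : x ∈ domain a M I)
    (hpsi : kerrPsi2 a M x ≠ 0) :
    HasDoublePNDPair (metric a M x) (weyl (metric a M) x) (vecL a M x) (vecK a M x) := by
  rw [kerrPsi2_eq hI hM hx] at hpsi
  rw [weyl_metric hI hM hx]
  exact hasDoublePNDPair_typeDTensor (metric_symm a M x) (isNullTetrad_kerr hx) hpsi

theorem isPetrovTypeD_kerr_iff (hI : IsOpen I) (hM : ContDiffOn ℝ 2 M I) (hx : x ∈ domain a M I) :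
    IsPetrovTypeD (metric a M x) (weyl (metric a M) x) ↔ kerrPsi2 a M x ≠ 0 := by
  rw [weyl_metric hI hM hx, kerrPsi2_eq hI hM hx]
  exact isPetrovTypeD_typeDTensor_iff (metric_symm a M x) (isNullTetrad_kerr hx)

end KerrPsi2

end KerrLike

end

theorem proposition1_general (a : ℝ) (ha : a ≠ 0) (I : Set ℝ) (hI : IsOpen I)
    (M : ℝ → ℝ) (hM : ContDiffOn ℝ 2 M I) :
    (∀ x ∈ KerrLike.domain a M I,
      KerrLike.IsNullTetrad (KerrLike.metric a M x)
        (KerrLike.vecL a M x) (KerrLike.vecK a M x) (KerrLike.vecM a x) ∧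
      KerrLike.Psi0 (KerrLike.weyl (KerrLike.metric a M) x)
        (KerrLike.vecL a M x) (KerrLike.vecM a x) = 0 ∧
      KerrLike.Psi1 (KerrLike.weyl (KerrLike.metric a M) x)
        (KerrLike.vecL a M x) (KerrLike.vecK a M x) (KerrLike.vecM a x) = 0 ∧
      KerrLike.Psi3 (KerrLike.weyl (KerrLike.metric a M) x)
        (KerrLike.vecL a M x) (KerrLike.vecK a M x) (KerrLike.vecM a x) = 0 ∧
      KerrLike.Psi4 (KerrLike.weyl (KerrLike.metric a M) x)
        (KerrLike.vecK a M x) (KerrLike.vecM a x) = 0 ∧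
      KerrLike.kerrPsi2 a M x =
        -((6 * KerrLike.rhoC a x * (M (x 1) : ℂ)
            - 2 * ((x 1 : ℂ) + KerrLike.rhoC a x) * KerrLike.rhoBar a x * ((deriv M (x 1) : ℝ) : ℂ)
            + (x 1 : ℂ) * KerrLike.rhoBar a x ^ 2 * ((deriv (deriv M) (x 1) : ℝ) : ℂ))
          / (6 * KerrLike.rhoC a x * KerrLike.rhoBar a x ^ 3)) ∧
      (KerrLike.kerrPsi2 a M x ≠ 0 →
        KerrLike.HasDoublePNDPair (KerrLike.metric a M x) (KerrLike.weyl (KerrLike.metric a M) x)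
          (KerrLike.vecL a M x) (KerrLike.vecK a M x)) ∧
      (KerrLike.IsPetrovTypeD (KerrLike.metric a M x) (KerrLike.weyl (KerrLike.metric a M) x) ↔
        KerrLike.kerrPsi2 a M x ≠ 0)) ∧
    IsOpen {x ∈ KerrLike.domain a M I | KerrLike.kerrPsi2 a M x ≠ 0} ∧
    {x ∈ KerrLike.domain a M I | M (x 1) ≠ 0} ⊆
      closure {x ∈ KerrLike.domain a M I | KerrLike.kerrPsi2 a M x ≠ 0} := by
  refine ⟨fun x hx => ?_, KerrLike.isOpen_kerrPsi2_ne_zero hI hM,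
    KerrLike.mass_ne_zero_subset_closure ha hI hM⟩
  have htetrad := KerrLike.isNullTetrad_kerr hx
  obtain ⟨h₀, h₁, -, h₃, h₄⟩ :=
    KerrLike.psi_typeDTensor (KerrLike.metric_symm a M x) htetrad (KerrLike.psi2 a M x)
  rw [← KerrLike.weyl_metric hI hM hx] at h₀ h₁ h₃ h₄
  exact ⟨htetrad, h₀, h₁, h₃, h₄, (KerrLike.kerrPsi2_eq hI hM hx).trans (KerrLike.psi2_eq hx.2.2.1),
    KerrLike.hasDoublePNDPair_kerr hI hM hx, KerrLike.isPetrovTypeD_kerr_iff hI hM hx⟩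

theorem proposition1 (a : ℝ) (ha : a ≠ 0) (I : Set ℝ) (hI : IsOpen I)
    (M : ℝ → ℝ) (hM : ContDiffOn ℝ 3 M I) :
    (∀ x ∈ KerrLike.domain a M I,
      KerrLike.IsNullTetrad (KerrLike.metric a M x)
        (KerrLike.vecL a M x) (KerrLike.vecK a M x) (KerrLike.vecM a x) ∧
      KerrLike.Psi0 (KerrLike.weyl (KerrLike.metric a M) x)
        (KerrLike.vecL a M x) (KerrLike.vecM a x) = 0 ∧
      KerrLike.Psi1 (KerrLike.weyl (KerrLike.metric a M) x)
        (KerrLike.vecL a M x) (KerrLike.vecK a M x) (KerrLike.vecM a x) = 0 ∧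
      KerrLike.Psi3 (KerrLike.weyl (KerrLike.metric a M) x)
        (KerrLike.vecL a M x) (KerrLike.vecK a M x) (KerrLike.vecM a x) = 0 ∧
      KerrLike.Psi4 (KerrLike.weyl (KerrLike.metric a M) x)
        (KerrLike.vecK a M x) (KerrLike.vecM a x) = 0 ∧
      KerrLike.kerrPsi2 a M x =
        -((6 * KerrLike.rhoC a x * (M (x 1) : ℂ)
            - 2 * ((x 1 : ℂ) + KerrLike.rhoC a x) * KerrLike.rhoBar a x * ((deriv M (x 1) : ℝ) : ℂ)
            + (x 1 : ℂ) * KerrLike.rhoBar a x ^ 2 * ((deriv (deriv M) (x 1) : ℝ) : ℂ))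
          / (6 * KerrLike.rhoC a x * KerrLike.rhoBar a x ^ 3)) ∧
      (KerrLike.kerrPsi2 a M x ≠ 0 →
        KerrLike.HasDoublePNDPair (KerrLike.metric a M x) (KerrLike.weyl (KerrLike.metric a M) x)
          (KerrLike.vecL a M x) (KerrLike.vecK a M x)) ∧
      (KerrLike.IsPetrovTypeD (KerrLike.metric a M x) (KerrLike.weyl (KerrLike.metric a M) x) ↔
        KerrLike.kerrPsi2 a M x ≠ 0)) ∧
    IsOpen {x ∈ KerrLike.domain a M I | KerrLike.kerrPsi2 a M x ≠ 0} ∧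
    {x ∈ KerrLike.domain a M I | M (x 1) ≠ 0} ⊆
      closure {x ∈ KerrLike.domain a M I | KerrLike.kerrPsi2 a M x ≠ 0} :=
  proposition1_general a ha I hI M (hM.of_le (by norm_num))
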